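/- **Outer bound for product broadcast channels.** Let $\mathcal X_1,\mathcal Y_1,\mathcal Z_1,\mathcal X_2,\mathcal Y_2,\mathcal Z_2$ be finite sets, let $\mathfrak q_1(y_1,z_1|x_1)$ and $\mathfrak q_2(y_2,z_2|x_2)$ be discrete memoryless broadcast channels, and let $$\mathfrak q(y_1y_2,z_1z_2|x_1x_2)=\mathfrak q_1(y_1,z_1|x_1)\,\mathfrak q_2(y_2,z_2|x_2)$$ be their product, with receivers $Y=(Y_1,Y_2)$ and $Z=(Z_1,Z_2)$. A triple $(R_0,R_1,R_2)$ of nonnegative reals is *achievable* for $\mathfrak q$ if there is a sequence, over block lengths $n$, of codes, each consisting of an encoder mapping $(m_0,m_1,m_2)$ to an input sequence of length $n$, a decoder at $Y$ estimating $(m_0,m_1)$ from the first output sequence, and a decoder at $Z$ estimating $(m_0,m_2)$ from the second output sequence, such that, when $M_0,M_1,M_2$ are independent and $M_i$ is uniform on the integers in $[1,2^{nR_i}]$, the error probabilities of both receivers tend to $0$ as $n\to\infty$. The *capacity region* is the closure of the set of achievable triples. Then every triple $(R_0,R_1,R_2)$ of the capacity region of $\mathfrak q$ belongs to the union, over all pairs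 of probability distributions $p_1(w_1,v_1,u_1,x_1)$, $p_2(w_2,v_2,u_2,x_2)$ (the auxiliary variables $W_i,V_i,U_i$ having arbitrary finite alphabets), of the sets of triples satisfying the following five conditions, where $$C:=\min\{I(W_1;Y_1)+I(W_2;Y_2),\; I(W_1;Z_1)+I(W_2;Z_2)\}:$$ \begin{align*} R_0 &\le C,\\ R_0+R_1 &\le C+I(U_1;Y_1|W_1)+I(U_2;Y_2|W_2),\\ R_0+R_2 &\le C+I(V_1;Z_1|W_1)+I(V_2;Z_2|W_2),\\ R_0+R_1+R_2 &\le C+I(U_2;Y_2|W_2)+I(X_2;Z_2|U_2,W_2)\\ &\quad+\min\{I(U_1;Y_1|W_1)+I(X_1;Z_1|U_1,W_1),\; I(V_1;Z_1|W_1)+I(X_1;Y_1|V_1,W_1)\},\\ R_0+R_1+R_2 &\le C+\min\{I(U_2;Y_2|W_2)+I(X_2;Z_2|U_2,W_2),\; I(V_2;Z_2|W_2)+I(X_2;Y_2|V_2,W_2)\}\\ &\quad+I(V_1;Z_1|W_1)+I(X_1;Y_1|V_1,W_1). \end{align*} Here the joint law is $p_1(w_1,v_1,u_1,x_1)\,p_2(w_2,v_2,u_2,x_2)\,\mathfrak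 q_1(y_1,z_1|x_1)\,\mathfrak q_2(y_2,z_2|x_2)$, and (conditional) mutual informations are measured in bits. -/

import Mathlib

open Filter Topology

noncomputable section

/-! ### Entropy and mutual information of finite random variables, in bits -/

section Information

variable {Ω A B C : Type*} [Fintype Ω] [Fintype A] [Fintype B] [Fintype C]

open Classical in
/-- The law of the random variable `f`, when the point `ω` has probability `P ω`. -/
def lawOf (P : Ω → ℝ) (f : Ω → A) (a : A) : ℝ :=
  ∑ ω, if f ω = a then P ω else 0

/-- Shannon entropy `H(f) = - ∑ₐ P(f = a) log₂ P(f = a)`. -/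
def entropyOf (P : Ω → ℝ) (f : Ω → A) : ℝ :=
  (∑ a, Real.negMulLog (lawOf P f a)) / Real.log 2

/-- Mutual information `I(f; g) = H(f) + H(g) - H(f, g)`. -/
def mutInfo (P : Ω → ℝ) (f : Ω → A) (g : Ω → B) : ℝ :=
  entropyOf P f + entropyOf P g - entropyOf P (fun ω => (f ω, g ω))

/-- Conditional mutual information
`I(f; g | h) = H(f, h) + H(g, h) - H(f, g, h) - H(h)`. -/
def condMutInfo (P : Ω → ℝ) (f : Ω → A) (g : Ω → B) (h : Ω → C) : ℝ :=
  entropyOf P (fun ω => (f ω, h ω)) + entropyOf P (fun ω => (g ω, h ω))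
    - entropyOf P (fun ω => (f ω, g ω, h ω)) - entropyOf P h

end Information

/-! ### Discrete memoryless broadcast channels, codes, and the capacity region -/

/-- A broadcast channel `q(y, z | x)` with finite alphabets: `q x` is a probability
vector on `Y × Z` for every input letter `x`. -/
abbrev BroadcastChannel (X Y Z : Type*) [Fintype Y] [Fintype Z] :=
  X → stdSimplex ℝ (Y × Z)

/-- The product channel `q(y₁y₂, z₁z₂ | x₁x₂) = q₁(y₁, z₁ | x₁) q₂(y₂, z₂ | x₂)`. -/
def BroadcastChannel.prod {X₁ Y₁ Z₁ X₂ Y₂ Z₂ : Type*}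
    [Fintype Y₁] [Fintype Z₁] [Fintype Y₂] [Fintype Z₂]
    (q₁ : BroadcastChannel X₁ Y₁ Z₁) (q₂ : BroadcastChannel X₂ Y₂ Z₂) :
    BroadcastChannel (X₁ × X₂) (Y₁ × Y₂) (Z₁ × Z₂) := fun x =>
  ⟨fun o => (q₁ x.1).1 (o.1.1, o.2.1) * (q₂ x.2).1 (o.1.2, o.2.2), by
    refine ⟨fun o => mul_nonneg ((q₁ x.1).2.1 _) ((q₂ x.2).2.1 _), ?_⟩
    rw [← (Equiv.prodProdProdComm Y₁ Z₁ Y₂ Z₂).sum_comp]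
    simp only [Equiv.prodProdProdComm_apply]
    rw [Fintype.sum_prod_type, ← Finset.sum_mul_sum, (q₁ x.1).2.2, (q₂ x.2).2.2, one_mul]⟩

/-- A block code of length `n` with `K₀`, `K₁`, `K₂` values of the common message, of the
private message of receiver `Y` and of the private message of receiver `Z`. -/
structure BroadcastCode (X Y Z : Type*) (n K₀ K₁ K₂ : ℕ) where
  /-- the encoder -/
  enc : Fin K₀ → Fin K₁ → Fin K₂ → (Fin n → X)
  /-- the estimate of the common message and of the first private message at receiver `Y` -/
  decY : (Fin n → Y) → Fin K₀ × Fin K₁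
  /-- the estimate of the common message and of the second private message at receiver `Z` -/
  decZ : (Fin n → Z) → Fin K₀ × Fin K₂

namespace BroadcastCode

variable {X Y Z : Type*} [Fintype Y] [Fintype Z] {n K₀ K₁ K₂ : ℕ}

open Classical in
/-- The probability that receiver `Y` does not recover the common message and its private
message, for independent, uniformly distributed messages and memoryless use of the channel. -/
def errY (q : BroadcastChannel X Y Z) (c : BroadcastCode X Y Z n K₀ K₁ K₂) : ℝ :=
  (∑ m₀, ∑ m₁, ∑ m₂, ∑ y : Fin n → Y, ∑ z : Fin n → Z,
    if c.decY y ≠ (m₀, m₁) then ∏ i, (q (c.enc m₀ m₁ m₂ i)).1 (y i, z i) else 0)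
    / ((K₀ : ℝ) * K₁ * K₂)

open Classical in
/-- The probability that receiver `Z` does not recover the common message and its private
message, for independent, uniformly distributed messages and memoryless use of the channel. -/
def errZ (q : BroadcastChannel X Y Z) (c : BroadcastCode X Y Z n K₀ K₁ K₂) : ℝ :=
  (∑ m₀, ∑ m₁, ∑ m₂, ∑ y : Fin n → Y, ∑ z : Fin n → Z,
    if c.decZ z ≠ (m₀, m₂) then ∏ i, (q (c.enc m₀ m₁ m₂ i)).1 (y i, z i) else 0)
    / ((K₀ : ℝ) * K₁ * K₂)

end BroadcastCode

/-- The number of integers in `[1, 2 ^ (n R)]`. -/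
def numMessages (n : ℕ) (R : ℝ) : ℕ := ⌊(2 : ℝ) ^ ((n : ℝ) * R)⌋₊

/-- A triple `(R₀, R₁, R₂)` of nonnegative rates is achievable if some sequence of codes of
lengths `n = 0, 1, 2, …` with messages in `[1 : 2 ^ (n Rᵢ)]` has both error probabilities
tending to zero. -/
def IsAchievable {X Y Z : Type*} [Fintype Y] [Fintype Z] (q : BroadcastChannel X Y Z)
    (R : ℝ × ℝ × ℝ) : Prop :=
  0 ≤ R.1 ∧ 0 ≤ R.2.1 ∧ 0 ≤ R.2.2 ∧
  ∃ c : ∀ n : ℕ, BroadcastCode X Y Z n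
      (numMessages n R.1) (numMessages n R.2.1) (numMessages n R.2.2),
    Tendsto (fun n => (c n).errY q) atTop (𝓝 0) ∧
    Tendsto (fun n => (c n).errZ q) atTop (𝓝 0)

/-- The capacity region with a common message: the closure of the achievable triples. -/
def capacityRegion {X Y Z : Type*} [Fintype Y] [Fintype Z] (q : BroadcastChannel X Y Z) :
    Set (ℝ × ℝ × ℝ) :=
  closure {R | IsAchievable q R}

/-! ### The outer bound for product channels -/

/-- The joint law `p(w, v, u, x) q(y, z | x)` of `(W, V, U, X, Y, Z)`; in particular
`(W, V, U) → X → (Y, Z)` is a Markov chain. -/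
def jointLaw {W V U X Y Z : Type*} [Fintype Y] [Fintype Z]
    (p : W × V × U × X → ℝ) (q : BroadcastChannel X Y Z) :
    (W × V × U × X) × (Y × Z) → ℝ :=
  fun ω => p ω.1 * (q ω.1.2.2.2).1 ω.2

section Terms

variable {W V U X Y Z : Type*}
  [Fintype W] [Fintype V] [Fintype U] [Fintype X] [Fintype Y] [Fintype Z]
  (p : W × V × U × X → ℝ) (q : BroadcastChannel X Y Z)

/-- `I(W; Y)` -/
def infoWY : ℝ := mutInfo (jointLaw p q) (fun ω => ω.1.1) (fun ω => ω.2.1)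

/-- `I(W; Z)` -/
def infoWZ : ℝ := mutInfo (jointLaw p q) (fun ω => ω.1.1) (fun ω => ω.2.2)

/-- `I(U; Y | W)` -/
def infoUY : ℝ :=
  condMutInfo (jointLaw p q) (fun ω => ω.1.2.2.1) (fun ω => ω.2.1) (fun ω => ω.1.1)

/-- `I(V; Z | W)` -/
def infoVZ : ℝ :=
  condMutInfo (jointLaw p q) (fun ω => ω.1.2.1) (fun ω => ω.2.2) (fun ω => ω.1.1)

/-- `I(X; Z | U, W)` -/
def infoXZ : ℝ :=
  condMutInfo (jointLaw p q) (fun ω => ω.1.2.2.2) (fun ω => ω.2.2)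
    (fun ω => (ω.1.2.2.1, ω.1.1))

/-- `I(X; Y | V, W)` -/
def infoXY : ℝ :=
  condMutInfo (jointLaw p q) (fun ω => ω.1.2.2.2) (fun ω => ω.2.1)
    (fun ω => (ω.1.2.1, ω.1.1))

end Terms

/-- `min {I(W₁; Y₁) + I(W₂; Y₂), I(W₁; Z₁) + I(W₂; Z₂)}` -/
def commonTerm {W₁ V₁ U₁ X₁ Y₁ Z₁ W₂ V₂ U₂ X₂ Y₂ Z₂ : Type*}
    [Fintype W₁] [Fintype V₁] [Fintype U₁] [Fintype X₁] [Fintype Y₁] [Fintype Z₁]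
    [Fintype W₂] [Fintype V₂] [Fintype U₂] [Fintype X₂] [Fintype Y₂] [Fintype Z₂]
    (p₁ : W₁ × V₁ × U₁ × X₁ → ℝ) (q₁ : BroadcastChannel X₁ Y₁ Z₁)
    (p₂ : W₂ × V₂ × U₂ × X₂ → ℝ) (q₂ : BroadcastChannel X₂ Y₂ Z₂) : ℝ :=
  min (infoWY p₁ q₁ + infoWY p₂ q₂) (infoWZ p₁ q₁ + infoWZ p₂ q₂)

/-- The triples allowed by the five inequalities for the law
`p₁(w₁, v₁, u₁, x₁) p₂(w₂, v₂, u₂, x₂)`. -/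
def regionOf {W₁ V₁ U₁ X₁ Y₁ Z₁ W₂ V₂ U₂ X₂ Y₂ Z₂ : Type*}
    [Fintype W₁] [Fintype V₁] [Fintype U₁] [Fintype X₁] [Fintype Y₁] [Fintype Z₁]
    [Fintype W₂] [Fintype V₂] [Fintype U₂] [Fintype X₂] [Fintype Y₂] [Fintype Z₂]
    (p₁ : W₁ × V₁ × U₁ × X₁ → ℝ) (q₁ : BroadcastChannel X₁ Y₁ Z₁)
    (p₂ : W₂ × V₂ × U₂ × X₂ → ℝ) (q₂ : BroadcastChannel X₂ Y₂ Z₂) :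
    Set (ℝ × ℝ × ℝ) :=
  {R | R.1 ≤ commonTerm p₁ q₁ p₂ q₂ ∧
    R.1 + R.2.1 ≤ commonTerm p₁ q₁ p₂ q₂ + infoUY p₁ q₁ + infoUY p₂ q₂ ∧
    R.1 + R.2.2 ≤ commonTerm p₁ q₁ p₂ q₂ + infoVZ p₁ q₁ + infoVZ p₂ q₂ ∧
    R.1 + R.2.1 + R.2.2 ≤ commonTerm p₁ q₁ p₂ q₂
      + infoUY p₂ q₂ + infoXZ p₂ q₂
      + min (infoUY p₁ q₁ + infoXZ p₁ q₁) (infoVZ p₁ q₁ + infoXY p₁ q₁) ∧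
    R.1 + R.2.1 + R.2.2 ≤ commonTerm p₁ q₁ p₂ q₂
      + min (infoUY p₂ q₂ + infoXZ p₂ q₂) (infoVZ p₂ q₂ + infoXY p₂ q₂)
      + infoVZ p₁ q₁ + infoXY p₁ q₁}

/-- The union of the regions over all probability distributions `p₁`, `p₂`, where the
auxiliary variables `Wᵢ`, `Vᵢ`, `Uᵢ` take values in arbitrary finite sets. -/
def productOuterBound {X₁ Y₁ Z₁ X₂ Y₂ Z₂ : Type*}
    [Fintype X₁] [Fintype Y₁] [Fintype Z₁] [Fintype X₂] [Fintype Y₂] [Fintype Z₂]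
    (q₁ : BroadcastChannel X₁ Y₁ Z₁) (q₂ : BroadcastChannel X₂ Y₂ Z₂) :
    Set (ℝ × ℝ × ℝ) :=
  {R | ∃ a₁ b₁ c₁ a₂ b₂ c₂ : ℕ,
    ∃ p₁ ∈ stdSimplex ℝ (Fin a₁ × Fin b₁ × Fin c₁ × X₁),
    ∃ p₂ ∈ stdSimplex ℝ (Fin a₂ × Fin b₂ × Fin c₂ × X₂),
      R ∈ regionOf p₁ q₁ p₂ q₂}

end

/-!
To every law `p(w, v, u, x)` of a component channel belongs the point consisting of the input
law and of the six entropies that occur in the bound. A law of `(U, V, W, X)` only enters through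
the posterior laws of the input, so the convex set of these points is the convex hull of a
compact set: convexity is time sharing, compactness makes the bound a closed set of rates, and
Carathéodory's theorem, applied once for `W` and, given `W`, separately for `U` and for `V`,
realises each point by finite auxiliary variables; `U` and `V` are then glued so that they are
conditionally independent given `(W, X)`.

For a code the messages are uniform and independent, and Fano's inequality bounds the rates by
multi-letter mutual informations. These are expanded letter by letter, in the first component with
the second output block `z₂ⁿ` of receiver `Z` as side information and in the second component with
the first output block `y₁ⁿ` of receiver `Y`. By Csiszár's sum identity, passing from block
entropies to letter entropies costs the same defect at both receivers, in each of the
conditionings `w`, `(u, w)`, `(v, w)`, `(u, v, w)`, and these defects cancel in all five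
inequalities.
-/

section Entropy

variable {Ω A B C D : Type*} [Fintype Ω] {P : Ω → ℝ}

theorem lawOf_nonneg (hP : ∀ ω, 0 ≤ P ω) (f : Ω → A) (a : A) : 0 ≤ lawOf P f a :=
  Finset.sum_nonneg fun ω _ => by split_ifs <;> simp [hP]

theorem le_lawOf_apply (hP : ∀ ω, 0 ≤ P ω) (f : Ω → A) (ω : Ω) : P ω ≤ lawOf P f (f ω) := by
  classical
  have h := Finset.single_le_sum (f := fun ω' => if f ω' = f ω then P ω' else 0)
    (fun ω' _ => by split_ifs <;> simp [hP]) (Finset.mem_univ ω)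
  simp only [if_true] at h
  unfold lawOf
  convert h

theorem lawOf_apply_pos (hP : ∀ ω, 0 ≤ P ω) (f : Ω → A) {ω : Ω} (hω : 0 < P ω) :
    0 < lawOf P f (f ω) :=
  hω.trans_le (le_lawOf_apply hP f ω)

theorem lawOf_mono (hP : ∀ ω, 0 ≤ P ω) {f : Ω → A} {g : Ω → B} {a : A} {b : B}
    (h : ∀ ω, f ω = a → g ω = b) : lawOf P f a ≤ lawOf P g b :=
  Finset.sum_le_sum fun ω _ => by
    split_ifs with hf hg hg
    exacts [le_rfl, absurd (h ω hf) hg, hP ω, le_rfl]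

theorem lawOf_congr {f : Ω → A} {g : Ω → B} {a : A} {b : B} (h : ∀ ω, f ω = a ↔ g ω = b) :
    lawOf P f a = lawOf P g b := by
  unfold lawOf
  refine Finset.sum_congr rfl fun ω _ => ?_
  congr 1
  exact propext (h ω)

theorem sum_lawOf_smul {E : Type*} [AddCommGroup E] [Module ℝ E] [Fintype A] (P : Ω → ℝ)
    (f : Ω → A) (g : A → E) : ∑ a, lawOf P f a • g a = ∑ ω, P ω • g (f ω) := by
  classical
  simp only [lawOf, Finset.sum_smul, ite_smul, zero_smul]
  rw [Finset.sum_comm]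
  simp only [Finset.sum_ite_eq, Finset.mem_univ, if_true]

theorem sum_lawOf_mul [Fintype A] (P : Ω → ℝ) (f : Ω → A) (g : A → ℝ) :
    ∑ a, lawOf P f a * g a = ∑ ω, P ω * g (f ω) :=
  sum_lawOf_smul P f g

theorem sum_lawOf [Fintype A] (P : Ω → ℝ) (f : Ω → A) : ∑ a, lawOf P f a = ∑ ω, P ω := by
  simpa using sum_lawOf_mul P f fun _ => 1

theorem sum_lawOf_prodMk [Fintype B] (P : Ω → ℝ) (f : Ω → A) (g : Ω → B) (a : A) :
    ∑ b, lawOf P (fun ω => (f ω, g ω)) (a, b) = lawOf P f a := by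
  classical
  simp only [lawOf, Prod.mk.injEq, ite_and]
  rw [Finset.sum_comm]
  exact Finset.sum_congr rfl fun ω _ => by by_cases h : f ω = a <;> simp [h]

theorem sum_lawOf_prodMk_left [Fintype A] (P : Ω → ℝ) (f : Ω → A) (g : Ω → B) (b : B) :
    ∑ a, lawOf P (fun ω => (f ω, g ω)) (a, b) = lawOf P g b := by
  rw [← sum_lawOf_prodMk P g f b]
  exact Finset.sum_congr rfl fun a _ => lawOf_congr fun ω => by simp [and_comm]

theorem entropyOf_eq_sum [Fintype A] (P : Ω → ℝ) (f : Ω → A) :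
    entropyOf P f = -(∑ ω, P ω * Real.log (lawOf P f (f ω))) / Real.log 2 := by
  unfold entropyOf
  rw [← sum_lawOf_mul P f fun a => Real.log (lawOf P f a), ← Finset.sum_neg_distrib]
  simp only [Real.negMulLog, neg_mul]

theorem entropyOf_congr [Fintype A] [Fintype B] {f : Ω → A} {g : Ω → B}
    (h : ∀ ω ω', f ω = f ω' ↔ g ω = g ω') : entropyOf P f = entropyOf P g := by
  simp only [entropyOf_eq_sum, lawOf_congr fun ω' => h ω' _]

theorem entropyOf_mono [Fintype A] [Fintype B] (hP : ∀ ω, 0 ≤ P ω) {f : Ω → A} {g : Ω → B}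
    (h : ∀ ω ω', g ω = g ω' → f ω = f ω') : entropyOf P f ≤ entropyOf P g := by
  simp only [entropyOf_eq_sum]
  gcongr ?_ / _
  refine neg_le_neg (Finset.sum_le_sum fun ω _ => ?_)
  rcases (hP ω).eq_or_lt with h0 | h0
  · simp [← h0]
  · exact mul_le_mul_of_nonneg_left (Real.log_le_log (lawOf_apply_pos hP g h0)
      (lawOf_mono hP fun ω' => h ω' ω)) h0.le

theorem entropyOf_const [Fintype A] (hP1 : ∑ ω, P ω = 1) (a : A) :
    entropyOf P (fun _ => a) = 0 := by
  rw [entropyOf_eq_sum]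
  simp [lawOf, hP1]

theorem entropyOf_uniform [Fintype A] [Nonempty A] {f : Ω → A}
    (hf : ∀ a, lawOf P f a = 1 / Fintype.card A) :
    entropyOf P f = Real.logb 2 (Fintype.card A) := by
  unfold entropyOf Real.logb
  simp only [hf, Finset.sum_const, Finset.card_univ, nsmul_eq_mul, Real.negMulLog, one_div,
    Real.log_inv]
  field_simp

theorem sum_mul_log_le [Fintype A] (hP : ∀ ω, 0 ≤ P ω) (f : Ω → A) {r : A → ℝ}
    (hr : ∀ a, 0 ≤ r a) (hr' : ∀ ω, 0 < P ω → 0 < r (f ω)) (hsum : ∑ a, r a ≤ ∑ ω, P ω) :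
    ∑ ω, P ω * Real.log (r (f ω)) ≤ ∑ ω, P ω * Real.log (lawOf P f (f ω)) := by
  have log_le : ∀ ω, P ω * Real.log (r (f ω)) - P ω * Real.log (lawOf P f (f ω))
      ≤ P ω * (r (f ω) / lawOf P f (f ω)) - P ω := by
    intro ω
    rcases (hP ω).eq_or_lt with h0 | h0
    · simp [← h0]
    · have hlaw := lawOf_apply_pos hP f h0
      rw [← mul_sub, ← Real.log_div (hr' ω h0).ne' hlaw.ne']
      nlinarith [Real.log_le_sub_one_of_pos (div_pos (hr' ω h0) hlaw)]
  have sum_ratio_le : ∑ ω, P ω * (r (f ω) / lawOf P f (f ω)) ≤ ∑ a, r a := by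
    rw [← sum_lawOf_mul P f fun a => r a / lawOf P f a]
    refine Finset.sum_le_sum fun a _ => ?_
    rcases (lawOf_nonneg hP f a).eq_or_lt with h0 | h0
    · simpa [← h0] using hr a
    · rw [mul_div_cancel₀ _ h0.ne']
  have h := Finset.sum_le_sum fun ω (_ : ω ∈ Finset.univ) => log_le ω
  rw [Finset.sum_sub_distrib, Finset.sum_sub_distrib] at h
  linarith

/-- Conditional Shannon entropy `H(f | g)`, in bits. -/
noncomputable def condEntropyOf [Fintype A] [Fintype B] (P : Ω → ℝ) (f : Ω → A) (g : Ω → B) : ℝ :=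
  entropyOf P (fun ω => (f ω, g ω)) - entropyOf P g

variable [Fintype A] [Fintype B] [Fintype C] [Fintype D]

theorem condEntropyOf_congr {f : Ω → A} {f' : Ω → B} {g : Ω → C} {g' : Ω → D}
    (hf : ∀ ω ω', f ω = f ω' ↔ f' ω = f' ω') (hg : ∀ ω ω', g ω = g ω' ↔ g' ω = g' ω') :
    condEntropyOf P f g = condEntropyOf P f' g' := by
  unfold condEntropyOf
  rw [entropyOf_congr hg, entropyOf_congr (g := fun ω => (f' ω, g' ω)) (by simp [hf, hg])]

theorem condEntropyOf_congr_right (f : Ω → A) {g : Ω → B} {g' : Ω → C}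
    (hg : ∀ ω ω', g ω = g ω' ↔ g' ω = g' ω') : condEntropyOf P f g = condEntropyOf P f g' :=
  condEntropyOf_congr (fun _ _ => Iff.rfl) hg

theorem condEntropyOf_const (hP1 : ∑ ω, P ω = 1) (f : Ω → A) (b : B) :
    condEntropyOf P f (fun _ => b) = entropyOf P f := by
  rw [condEntropyOf, entropyOf_const hP1, sub_zero, entropyOf_congr (g := f) (by simp)]

theorem condEntropyOf_nonneg (hP : ∀ ω, 0 ≤ P ω) (f : Ω → A) (g : Ω → B) :
    0 ≤ condEntropyOf P f g :=
  sub_nonneg.2 (entropyOf_mono hP (by simp))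

theorem condEntropyOf_prodMk (f : Ω → A) (g : Ω → B) (h : Ω → C) :
    condEntropyOf P (fun ω => (f ω, g ω)) h
      = condEntropyOf P f (fun ω => (g ω, h ω)) + condEntropyOf P g h := by
  unfold condEntropyOf
  rw [entropyOf_congr (f := fun ω => ((f ω, g ω), h ω)) (g := fun ω => (f ω, g ω, h ω))
    (by simp [and_assoc])]
  ring

theorem condEntropyOf_prodMk' (f : Ω → A) (g : Ω → B) (h : Ω → C) :
    condEntropyOf P (fun ω => (f ω, g ω)) h
      = condEntropyOf P g (fun ω => (f ω, h ω)) + condEntropyOf P f h := by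
  rw [← condEntropyOf_prodMk, condEntropyOf_congr (f' := fun ω => (g ω, f ω)) (g' := h)
    (by simp [and_comm]) (by simp)]

theorem condEntropyOf_le_crossEntropy (hP : ∀ ω, 0 ≤ P ω) (f : Ω → A) (g : Ω → B)
    {r : B → A → ℝ} (hr : ∀ b a, 0 ≤ r b a) (hr' : ∀ ω, 0 < P ω → 0 < r (g ω) (f ω))
    (hsum : ∀ b, ∑ a, r b a ≤ 1) :
    condEntropyOf P f g ≤ -(∑ ω, P ω * Real.log (r (g ω) (f ω))) / Real.log 2 := by
  have gibbs := sum_mul_log_le hP (fun ω => (f ω, g ω)) (r := fun t => lawOf P g t.2 * r t.2 t.1)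
    (fun t => mul_nonneg (lawOf_nonneg hP _ _) (hr _ _))
    (fun ω h0 => mul_pos (lawOf_apply_pos hP g h0) (hr' ω h0)) (by
      rw [← sum_lawOf P g, Fintype.sum_prod_type_right]
      simp only [← Finset.mul_sum]
      exact Finset.sum_le_sum fun b _ => mul_le_of_le_one_right (lawOf_nonneg hP _ _) (hsum b))
  have log_mul : ∀ ω, P ω * Real.log (lawOf P g (g ω) * r (g ω) (f ω))
      = P ω * Real.log (lawOf P g (g ω)) + P ω * Real.log (r (g ω) (f ω)) := by
    intro ω
    rcases (hP ω).eq_or_lt with h0 | h0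
    · simp [← h0]
    · rw [Real.log_mul (lawOf_apply_pos hP g h0).ne' (hr' ω h0).ne', mul_add]
  simp only [log_mul, Finset.sum_add_distrib] at gibbs
  rw [condEntropyOf, entropyOf_eq_sum, entropyOf_eq_sum, ← sub_div]
  gcongr
  linarith

theorem condEntropyOf_prodMk_right_le (hP : ∀ ω, 0 ≤ P ω) (f : Ω → A) (g : Ω → B) (h : Ω → C) :
    condEntropyOf P f (fun ω => (g ω, h ω)) ≤ condEntropyOf P f h := by
  refine (condEntropyOf_le_crossEntropy hP f _
    (r := fun t a => lawOf P (fun ω => (f ω, h ω)) (a, t.2) / lawOf P h t.2)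
    (fun t a => div_nonneg (lawOf_nonneg hP _ _) (lawOf_nonneg hP _ _))
    (fun ω h0 => div_pos (lawOf_apply_pos hP (fun ω => (f ω, h ω)) h0) (lawOf_apply_pos hP h h0))
    (fun t => ?_)).trans_eq ?_
  · rw [← Finset.sum_div, sum_lawOf_prodMk_left]
    exact div_self_le_one _
  · have log_div : ∀ ω, P ω * Real.log (lawOf P (fun ω => (f ω, h ω)) (f ω, h ω) / lawOf P h (h ω))
        = P ω * Real.log (lawOf P (fun ω => (f ω, h ω)) (f ω, h ω))
          - P ω * Real.log (lawOf P h (h ω)) := by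
      intro ω
      rcases (hP ω).eq_or_lt with h0 | h0
      · simp [← h0]
      · rw [Real.log_div (lawOf_apply_pos hP (fun ω => (f ω, h ω)) h0).ne'
          (lawOf_apply_pos hP h h0).ne', mul_sub]
    simp only [log_div, Finset.sum_sub_distrib]
    rw [condEntropyOf, entropyOf_eq_sum, entropyOf_eq_sum]
    ring

theorem condEntropyOf_anti (hP : ∀ ω, 0 ≤ P ω) (f : Ω → A) {g : Ω → B} {h : Ω → C}
    (hgh : ∀ ω ω', g ω = g ω' → h ω = h ω') : condEntropyOf P f g ≤ condEntropyOf P f h := by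
  refine le_of_eq_of_le (condEntropyOf_congr_right f fun ω ω' => ?_)
    (condEntropyOf_prodMk_right_le hP f g h)
  simpa using hgh ω ω'

theorem condEntropyOf_le_entropyOf (hP : ∀ ω, 0 ≤ P ω) (hP1 : ∑ ω, P ω = 1) (f : Ω → A)
    (g : Ω → B) : condEntropyOf P f g ≤ entropyOf P f :=
  (condEntropyOf_anti hP f (h := fun _ => ()) (by simp)).trans_eq (condEntropyOf_const hP1 f ())

open Classical in
/-- Fano's inequality. -/
theorem condEntropyOf_le_of_decoder (hP : ∀ ω, 0 ≤ P ω) (hP1 : ∑ ω, P ω = 1)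
    (f : Ω → A) (g : Ω → B) (d : B → A) :
    condEntropyOf P f g
      ≤ 1 + (∑ ω, if d (g ω) ≠ f ω then P ω else 0) * Real.logb 2 (Fintype.card A) := by
  have : Nonempty Ω := by
    by_contra h
    simp [not_nonempty_iff.1 h] at hP1
  have : Nonempty A := ‹Nonempty Ω›.map f
  set K : ℝ := (Fintype.card A : ℝ) with hK
  have hK0 : 0 < K := by positivity
  -- Half of the mass sits on the decoded value, the other half is spread uniformly.
  let r : B → A → ℝ := fun b a => if d b = a then 1 / 2 else 1 / (2 * K)
  have r_pos : ∀ b a, 0 < r b a := fun b a => by simp only [r]; split_ifs <;> positivity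
  have r_le : ∀ b a, r b a ≤ (if d b = a then 1 / 2 else 0) + 1 / (2 * K) := fun b a => by
    have : 0 < 1 / (2 * K) := by positivity
    simp only [r]; split_ifs <;> linarith
  have sum_r_le : ∀ b, ∑ a, r b a ≤ 1 := fun b => by
    refine (Finset.sum_le_sum fun a _ => r_le b a).trans_eq ?_
    simp only [Finset.sum_add_distrib, Finset.sum_ite_eq, Finset.mem_univ, if_true,
      Finset.sum_const, Finset.card_univ, nsmul_eq_mul, ← hK]
    field_simp
    norm_num
  have log_r : ∀ ω, P ω * Real.log (r (g ω) (f ω))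
      = -(P ω * Real.log 2) - (if d (g ω) ≠ f ω then P ω else 0) * Real.log K := fun ω => by
    simp only [r, ne_eq, ite_not]
    split_ifs <;> rw [one_div, Real.log_inv]
    · ring
    · rw [Real.log_mul two_ne_zero hK0.ne']; ring
  refine (condEntropyOf_le_crossEntropy hP f g (fun b a => (r_pos b a).le)
    (fun ω _ => r_pos _ _) sum_r_le).trans_eq ?_
  simp only [log_r, Finset.sum_sub_distrib, Finset.sum_neg_distrib, ← Finset.sum_mul, hP1, one_mul,
    Real.logb]
  have := (Real.log_pos one_lt_two).ne'
  field_simp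
  ring

theorem mutInfo_eq_sub (f : Ω → A) (g : Ω → B) :
    mutInfo P f g = entropyOf P g - condEntropyOf P g f := by
  rw [mutInfo, condEntropyOf, entropyOf_congr (f := fun ω => (g ω, f ω))
    (g := fun ω => (f ω, g ω)) (by simp [and_comm])]
  ring

theorem mutInfo_eq_sub' (f : Ω → A) (g : Ω → B) :
    mutInfo P f g = entropyOf P f - condEntropyOf P f g := by
  rw [mutInfo, condEntropyOf]
  ring

theorem condMutInfo_eq_sub (f : Ω → A) (g : Ω → B) (h : Ω → C) :
    condMutInfo P f g h = condEntropyOf P g h - condEntropyOf P g (fun ω => (f ω, h ω)) := by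
  rw [condMutInfo, condEntropyOf, condEntropyOf, entropyOf_congr (f := fun ω => (g ω, f ω, h ω))
    (g := fun ω => (f ω, g ω, h ω)) (by simp [and_left_comm])]
  ring

theorem condMutInfo_eq_sub' (f : Ω → A) (g : Ω → B) (h : Ω → C) :
    condMutInfo P f g h = condEntropyOf P f h - condEntropyOf P f (fun ω => (g ω, h ω)) := by
  rw [condMutInfo, condEntropyOf, condEntropyOf]
  ring

theorem entropyOf_sub_condEntropyOf_prodMk_le_mutInfo (hP : ∀ ω, 0 ≤ P ω) (f : Ω → A) (g : Ω → B)
    (h : Ω → C) :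
    entropyOf P f - condEntropyOf P (fun ω => (f ω, g ω)) h ≤ mutInfo P f h := by
  rw [mutInfo_eq_sub', condEntropyOf_prodMk']
  linarith [condEntropyOf_nonneg hP g fun ω => (f ω, h ω)]

theorem condEntropyOf_sub_condEntropyOf_prodMk_le_condMutInfo (hP : ∀ ω, 0 ≤ P ω) (f : Ω → A)
    (g : Ω → B) (h : Ω → C) :
    condEntropyOf P g f - condEntropyOf P (fun ω => (f ω, g ω)) h ≤ condMutInfo P g h f := by
  rw [condMutInfo_eq_sub', condEntropyOf_prodMk',
    condEntropyOf_congr_right g (g := fun ω => (f ω, h ω)) (g' := fun ω => (h ω, f ω))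
      (by simp [and_comm])]
  linarith [condEntropyOf_nonneg hP f h]

/-- The hypothesis says that `f` and `k` are conditionally independent given `h`. -/
theorem condMutInfo_le_condMutInfo_prodMk (hP : ∀ ω, 0 ≤ P ω) (f : Ω → A) (g : Ω → B) (h : Ω → C)
    (k : Ω → D) (hk : condEntropyOf P f (fun ω => (k ω, h ω)) = condEntropyOf P f h) :
    condMutInfo P f g h ≤ condMutInfo P f g (fun ω => (k ω, h ω)) := by
  rw [condMutInfo_eq_sub', condMutInfo_eq_sub', hk]
  exact sub_le_sub_left (condEntropyOf_anti hP f (by simp +contextual)) _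

end Entropy

section OutputEntropy

variable {X Y : Type*} [Fintype X] [Fintype Y] {k : X → Y → ℝ}

/-- The entropy (in bits) of the output of the kernel `k` for an input distributed according to
the normalization of the finite measure `m`, times the mass of `m`. With this factor the entropy
of the output given further data is the sum of `outputEntropy k` over the values of the data. -/
noncomputable def outputEntropy (k : X → Y → ℝ) (m : X → ℝ) : ℝ :=
  (∑ y, Real.negMulLog (∑ x, m x * k x y) - Real.negMulLog (∑ x, m x)) / Real.log 2

/-- The entropy (in bits) of the output of the kernel `k` given its input, for the input
distribution `m`. -/
noncomputable def noiseEntropy (k : X → Y → ℝ) (m : X → ℝ) : ℝ :=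
  (∑ x, m x * ∑ y, Real.negMulLog (k x y)) / Real.log 2

theorem outputEntropy_smul (hk : ∀ x, ∑ y, k x y = 1) (c : ℝ) (m : X → ℝ) :
    outputEntropy k (c • m) = c * outputEntropy k m := by
  have sum_out : ∑ y, ∑ x, m x * k x y = ∑ x, m x := by
    rw [Finset.sum_comm]
    simp [← Finset.mul_sum, hk]
  simp only [outputEntropy, Pi.smul_apply, smul_eq_mul, mul_assoc, ← Finset.mul_sum,
    Real.negMulLog_mul, Finset.sum_add_distrib, ← Finset.sum_mul, sum_out]
  ring

theorem outputEntropy_of_mem_stdSimplex {m : X → ℝ} (hm : m ∈ stdSimplex ℝ X) :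
    outputEntropy k m = (∑ y, Real.negMulLog (∑ x, m x * k x y)) / Real.log 2 := by
  simp [outputEntropy, hm.2]

@[fun_prop]
theorem continuous_outputEntropy : Continuous (outputEntropy k) := by
  unfold outputEntropy
  have := Real.continuous_negMulLog
  fun_prop

@[fun_prop]
theorem continuous_noiseEntropy : Continuous (noiseEntropy k) := by
  unfold noiseEntropy
  fun_prop

theorem concaveOn_outputEntropy (hk : ∀ x y, 0 ≤ k x y) :
    ConcaveOn ℝ (stdSimplex ℝ X) (outputEntropy k) := by
  refine ⟨convex_stdSimplex ℝ X, fun p hp q hq a b ha hb hab => ?_⟩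
  rw [outputEntropy_of_mem_stdSimplex hp, outputEntropy_of_mem_stdSimplex hq,
    outputEntropy_of_mem_stdSimplex (convex_stdSimplex ℝ X hp hq ha hb hab)]
  simp only [smul_eq_mul, ← mul_div_assoc, ← add_div, Finset.mul_sum, ← Finset.sum_add_distrib]
  gcongr ?_ / _
  refine Finset.sum_le_sum fun y _ => ?_
  have output_nonneg : ∀ m ∈ stdSimplex ℝ X, ∑ x, m x * k x y ∈ Set.Ici 0 := fun m hm =>
    Finset.sum_nonneg fun x _ => mul_nonneg (hm.1 x) (hk x y)
  refine (Real.concaveOn_negMulLog.2 (output_nonneg p hp) (output_nonneg q hq) ha hb hab).trans_eq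
    (congrArg _ ?_)
  simp only [smul_eq_mul, Finset.mul_sum, ← Finset.sum_add_distrib, Pi.add_apply, Pi.smul_apply]
  exact Finset.sum_congr rfl fun x _ => by ring

theorem noiseEntropy_sum_smul {ι : Type*} (s : Finset ι) (c : ι → ℝ) (m : ι → X → ℝ) :
    noiseEntropy k (∑ i ∈ s, c i • m i) = ∑ i ∈ s, c i * noiseEntropy k (m i) := by
  simp only [noiseEntropy, Finset.sum_apply, Pi.smul_apply, smul_eq_mul, Finset.sum_mul,
    mul_assoc, ← mul_div_assoc, ← Finset.sum_div, Finset.mul_sum (Finset.univ : Finset X)]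
  rw [Finset.sum_comm]

end OutputEntropy

section IsOutput

variable {Ω S T X Y O R : Type*} [Fintype Ω] {P : Ω → ℝ}

/-- `f → g → h` is a Markov chain and `h` is the output of the kernel `k` for the input `g`. The
equation is multiplicative, hence meaningful at values of `(f, g)` of probability zero. -/
def IsOutput (P : Ω → ℝ) (f : Ω → S) (g : Ω → X) (h : Ω → Y) (k : X → Y → ℝ) : Prop :=
  ∀ s x y, lawOf P (fun ω => (f ω, g ω, h ω)) (s, x, y)
    = lawOf P (fun ω => (f ω, g ω)) (s, x) * k x y

open Classical in
theorem lawOf_prodMk_comp [Fintype S] (f : Ω → S) (φ : S → T) (g : Ω → X) (t : T) (x : X) :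
    lawOf P (fun ω => (φ (f ω), g ω)) (t, x)
      = ∑ s, if φ s = t then lawOf P (fun ω => (f ω, g ω)) (s, x) else 0 := by
  simp only [lawOf, Prod.mk.injEq]
  rw [← Finset.sum_filter fun s => φ s = t, Finset.sum_comm' (t' := Finset.univ)
    (s' := fun _ => Finset.univ.filter fun s => φ s = t) (by simp)]
  refine Finset.sum_congr rfl fun ω _ => ?_
  simp only [ite_and, Finset.sum_ite_eq, Finset.mem_filter, Finset.mem_univ, true_and]

namespace IsOutput

variable {f : Ω → S} {g : Ω → X} {h : Ω → Y} {k : X → Y → ℝ}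

theorem comp_left [Finite S] (H : IsOutput P f g h k) (φ : S → T) :
    IsOutput P (fun ω => φ (f ω)) g h k := by
  classical
  have := Fintype.ofFinite S
  intro t x y
  rw [lawOf_prodMk_comp f φ fun ω => (g ω, h ω), lawOf_prodMk_comp f φ g, Finset.sum_mul]
  exact Finset.sum_congr rfl fun s _ => by rw [H, ite_mul, zero_mul]

theorem comp_right [Fintype Y] (H : IsOutput P f g h k) (η : Y → O) :
    IsOutput P f g (fun ω => η (h ω)) fun x => lawOf (k x) η := by
  classical
  intro s x o
  rw [lawOf_congr (g := fun ω => (η (h ω), f ω, g ω)) (b := (o, s, x)) (by simp; tauto),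
    lawOf_prodMk_comp h η fun ω => (f ω, g ω)]
  simp only [lawOf.eq_1 (k x), Finset.mul_sum]
  refine Finset.sum_congr rfl fun y _ => ?_
  rw [mul_ite, mul_zero, ← H, lawOf_congr (f := fun ω => (h ω, f ω, g ω))
    (g := fun ω => (f ω, g ω, h ω)) (b := (s, x, y)) (by simp; tauto)]

theorem lawOf_eq_sum [Fintype X] (H : IsOutput P f g h k) (s : S) (y : Y) :
    lawOf P (fun ω => (f ω, h ω)) (s, y) = ∑ x, lawOf P (fun ω => (f ω, g ω)) (s, x) * k x y := by
  rw [← sum_lawOf_prodMk P (fun ω => (f ω, h ω)) g]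
  exact Finset.sum_congr rfl fun x _ => (lawOf_congr (by simp; tauto)).trans (H s x y)

theorem condEntropyOf_eq_sum [Fintype S] [Fintype X] [Fintype Y] (H : IsOutput P f g h k) :
    condEntropyOf P h f = ∑ s, outputEntropy k fun x => lawOf P (fun ω => (f ω, g ω)) (s, x) := by
  rw [condEntropyOf, entropyOf_congr (g := fun ω => (f ω, h ω)) (by simp [and_comm])]
  unfold entropyOf outputEntropy
  rw [← sub_div, ← Finset.sum_div, Finset.sum_sub_distrib, Fintype.sum_prod_type]
  simp only [H.lawOf_eq_sum, sum_lawOf_prodMk]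

theorem entropyOf_eq [Finite S] [Fintype X] [Fintype Y] (hP1 : ∑ ω, P ω = 1)
    (H : IsOutput P f g h k) : entropyOf P h = outputEntropy k (lawOf P g) := by
  rw [← condEntropyOf_const hP1 h (), (H.comp_left fun _ => ()).condEntropyOf_eq_sum,
    Finset.univ_unique, Finset.sum_singleton]
  exact congrArg _ (funext fun x => lawOf_congr (by simp))

theorem condEntropyOf_eq_noiseEntropy [Fintype S] [Fintype X] [Fintype Y]
    (H : IsOutput P f g h k) (hk : ∀ x, ∑ y, k x y = 1) {φ : S → X} (hφ : ∀ ω, g ω = φ (f ω)) :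
    condEntropyOf P h f = noiseEntropy k (lawOf P g) := by
  classical
  have law_fg : ∀ s x, lawOf P (fun ω => (f ω, g ω)) (s, x) = if φ s = x then lawOf P f s else 0 :=
    fun s x => by
      split_ifs with hx
      · exact lawOf_congr fun ω => by simp only [Prod.mk.injEq, hφ]; grind
      · exact Finset.sum_eq_zero fun ω _ => if_neg (by simp only [Prod.mk.injEq, hφ]; grind)
  have law_fh : ∀ s, outputEntropy k (fun x => lawOf P (fun ω => (f ω, g ω)) (s, x))
      = lawOf P f s * (∑ y, Real.negMulLog (k (φ s) y)) / Real.log 2 := fun s => by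
    simp only [outputEntropy, law_fg, ite_mul, zero_mul, Finset.sum_ite_eq, Finset.mem_univ,
      if_true, Real.negMulLog_mul, Finset.sum_add_distrib, ← Finset.sum_mul, hk, one_mul,
      ← Finset.mul_sum, add_sub_cancel_left]
  rw [H.condEntropyOf_eq_sum, noiseEntropy]
  simp only [law_fh, ← Finset.sum_div]
  rw [sum_lawOf_mul P f fun s => ∑ y, Real.negMulLog (k (φ s) y),
    sum_lawOf_mul P g fun x => ∑ y, Real.negMulLog (k x y)]
  simp only [hφ]

end IsOutput

theorem isOutput_of_equiv [Fintype O] [Finite R] (e : Ω ≃ R × O) {Q : R → ℝ} {ξ : R → X}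
    {κ : X → O → ℝ} (hκ : ∀ x, ∑ o, κ x o = 1) (hP : ∀ ω, P ω = Q (e ω).1 * κ (ξ (e ω).1) (e ω).2)
    {f : Ω → S} (hf : ∀ ω ω', (e ω).1 = (e ω').1 → f ω = f ω') :
    IsOutput P f (fun ω => ξ (e ω).1) (fun ω => (e ω).2) κ := by
  classical
  have := Fintype.ofFinite R
  intro s x o
  unfold lawOf
  rw [← e.symm.sum_comp, ← e.symm.sum_comp, Fintype.sum_prod_type, Fintype.sum_prod_type,
    Finset.sum_mul]
  refine Finset.sum_congr rfl fun r _ => ?_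
  have f_eq : ∀ o', f (e.symm (r, o')) = f (e.symm (r, o)) := fun o' => hf _ _ (by simp)
  simp only [hP, Equiv.apply_symm_apply, Prod.mk.injEq, f_eq]
  by_cases h : f (e.symm (r, o)) = s ∧ ξ r = x
  · obtain ⟨rfl, rfl⟩ := h
    simp [← Finset.mul_sum, hκ]
  · simp [← and_assoc, h]

end IsOutput

section Csiszar

variable {Ω S A B : Type*} {P : Ω → ℝ} {n : ℕ}

/-- The variable `s` together with the coordinates of `f` before `i` and the coordinates of `g`
from `j` on: the conditioning in the two sums of Csiszár's identity, where `j = i + 1`. -/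
def pastFuture (s : Ω → S) (f : Fin n → Ω → A) (g : Fin n → Ω → B) (i j : ℕ) (ω : Ω) :
    S × ({l : Fin n // l.1 < i} → A) × ({l : Fin n // j ≤ l.1} → B) :=
  (s ω, fun l => f l.1 ω, fun l => g l.1 ω)

theorem pastFuture_eq_iff (s : Ω → S) (f : Fin n → Ω → A) (g : Fin n → Ω → B) (i j : ℕ)
    (ω ω' : Ω) : pastFuture s f g i j ω = pastFuture s f g i j ω' ↔
      s ω = s ω' ∧ (∀ l : Fin n, l.1 < i → f l ω = f l ω') ∧
        ∀ l : Fin n, j ≤ l.1 → g l ω = g l ω' := by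
  simp [pastFuture, funext_iff]

variable [Fintype Ω] [Fintype S] [Fintype A] [Fintype B]
  (s : Ω → S) (f : Fin n → Ω → A) (g : Fin n → Ω → B)

theorem condEntropyOf_pastFuture_left (i : Fin n) (j : ℕ) :
    condEntropyOf P (f i) (pastFuture s f g i j)
      = entropyOf P (pastFuture s f g (i + 1) j) - entropyOf P (pastFuture s f g i j) := by
  refine congrArg (· - _) (entropyOf_congr fun ω ω' => ?_)
  simp only [Prod.mk.injEq, pastFuture_eq_iff, Nat.lt_succ_iff_lt_or_eq, ← Fin.ext_iff]
  grind

theorem condEntropyOf_pastFuture_right (i : Fin n) (j : ℕ) :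
    condEntropyOf P (g i) (pastFuture s f g j (i + 1))
      = entropyOf P (pastFuture s f g j i) - entropyOf P (pastFuture s f g j (i + 1)) := by
  refine congrArg (· - _) (entropyOf_congr fun ω ω' => ?_)
  simp only [Prod.mk.injEq, pastFuture_eq_iff, le_iff_lt_or_eq, ← Fin.ext_iff]
  grind

theorem entropyOf_pastFuture_past :
    entropyOf P (pastFuture s f g n n) = entropyOf P (fun ω => (fun i => f i ω, s ω)) :=
  entropyOf_congr fun ω ω' => by
    simp only [Prod.mk.injEq, pastFuture_eq_iff, funext_iff]
    grind

theorem entropyOf_pastFuture_future :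
    entropyOf P (pastFuture s f g 0 0) = entropyOf P (fun ω => (fun i => g i ω, s ω)) :=
  entropyOf_congr fun ω ω' => by
    simp only [Prod.mk.injEq, pastFuture_eq_iff, funext_iff]
    grind

theorem entropyOf_pastFuture_none :
    entropyOf P (pastFuture s f g 0 n) = entropyOf P s :=
  entropyOf_congr fun ω ω' => by
    simp only [pastFuture_eq_iff]
    grind

/-- The sum of the conditional entropies `H(f i | s, f 0, …, f (i - 1), g (i + 1), …)`, the first
of the two sums in Csiszár's identity. -/
noncomputable def csiszarLeft (P : Ω → ℝ) (s : Ω → S) (f : Fin n → Ω → A) (g : Fin n → Ω → B) :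
    ℝ :=
  ∑ i : Fin n, condEntropyOf P (f i) (pastFuture s f g i (i + 1))

/-- The sum of the conditional entropies `H(g i | s, f 0, …, f (i - 1), g (i + 1), …)`, the second
of the two sums in Csiszár's identity. -/
noncomputable def csiszarRight (P : Ω → ℝ) (s : Ω → S) (f : Fin n → Ω → A) (g : Fin n → Ω → B) :
    ℝ :=
  ∑ i : Fin n, condEntropyOf P (g i) (pastFuture s f g i (i + 1))

theorem csiszarLeft_sub_csiszarRight :
    csiszarLeft P s f g - csiszarRight P s f g
      = condEntropyOf P (fun ω i => f i ω) s - condEntropyOf P (fun ω i => g i ω) s := by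
  simp only [csiszarLeft, csiszarRight, ← Finset.sum_sub_distrib, condEntropyOf_pastFuture_left,
    condEntropyOf_pastFuture_right, sub_sub_sub_cancel_right]
  rw [Fin.sum_univ_eq_sum_range (fun i => entropyOf P (pastFuture s f g (i + 1) (i + 1))
    - entropyOf P (pastFuture s f g i i)) n,
    Finset.sum_range_sub (fun i => entropyOf P (pastFuture s f g i i)), entropyOf_pastFuture_past,
    entropyOf_pastFuture_future, condEntropyOf, condEntropyOf, sub_sub_sub_cancel_right]

theorem sum_condEntropyOf_past :
    ∑ i : Fin n, condEntropyOf P (f i) (pastFuture s f g i n)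
      = condEntropyOf P (fun ω i => f i ω) s := by
  simp only [condEntropyOf_pastFuture_left]
  rw [Fin.sum_univ_eq_sum_range (fun i => entropyOf P (pastFuture s f g (i + 1) n)
    - entropyOf P (pastFuture s f g i n)) n,
    Finset.sum_range_sub (fun i => entropyOf P (pastFuture s f g i n)), entropyOf_pastFuture_past,
    entropyOf_pastFuture_none, condEntropyOf]

theorem csiszarLeft_le (hP : ∀ ω, 0 ≤ P ω) :
    csiszarLeft P s f g ≤ condEntropyOf P (fun ω i => f i ω) s := by
  rw [← sum_condEntropyOf_past s f g]
  refine Finset.sum_le_sum fun i _ => condEntropyOf_anti hP _ fun ω ω' => ?_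
  simp only [pastFuture_eq_iff]
  grind

theorem entropyOf_pi_le (hP : ∀ ω, 0 ≤ P ω) (hP1 : ∑ ω, P ω = 1) :
    entropyOf P (fun ω i => f i ω) ≤ ∑ i, entropyOf P (f i) := by
  rw [← condEntropyOf_const hP1 _ (), ← sum_condEntropyOf_past (fun _ => ()) f f]
  exact Finset.sum_le_sum fun i _ => condEntropyOf_le_entropyOf hP hP1 _ _

/-- The pair of the blocks `(f 0, …, f (n - 1))` and `(g 0, …, g (n - 1))`, as a random variable. -/
def blockPair (f : Fin n → Ω → A) (g : Fin n → Ω → B) : Ω → (Fin n → A) × (Fin n → B) :=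
  fun ω => (fun i => f i ω, fun i => g i ω)

theorem entropyOf_blockPair_le (hP : ∀ ω, 0 ≤ P ω) (hP1 : ∑ ω, P ω = 1) :
    entropyOf P (blockPair f g)
      ≤ entropyOf P (fun ω i => f i ω) + entropyOf P (fun ω i => g i ω) :=
  sub_le_iff_le_add.1 (condEntropyOf_le_entropyOf hP hP1 (fun ω i => f i ω) fun ω i => g i ω)

/-- If the first component is single-letterized with the side information `(z₂ⁿ, s)` and the
second one with `(y₁ⁿ, s)`, the same quantity `D` measures what the Csiszár sums lose against the
entropies of the three blocks `(y₁ⁿ, y₂ⁿ)`, `(z₁ⁿ, z₂ⁿ)` and `(y₁ⁿ, z₂ⁿ)`. -/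
theorem exists_csiszar_defect {Y₁ Z₁ Y₂ Z₂ : Type*} [Fintype Y₁] [Fintype Z₁] [Fintype Y₂]
    [Fintype Z₂] (hP : ∀ ω, 0 ≤ P ω) (s : Ω → S) (y₁ : Fin n → Ω → Y₁) (z₁ : Fin n → Ω → Z₁)
    (y₂ : Fin n → Ω → Y₂) (z₂ : Fin n → Ω → Z₂) :
    ∃ D, 0 ≤ D ∧
      condEntropyOf P (blockPair y₁ y₂) s
        = csiszarLeft P (fun ω => (fun i => z₂ i ω, s ω)) y₁ z₁
          + csiszarLeft P (fun ω => (fun i => y₁ i ω, s ω)) y₂ z₂ + D ∧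
      condEntropyOf P (blockPair z₁ z₂) s
        = csiszarRight P (fun ω => (fun i => z₂ i ω, s ω)) y₁ z₁
          + csiszarRight P (fun ω => (fun i => y₁ i ω, s ω)) y₂ z₂ + D ∧
      condEntropyOf P (blockPair y₁ z₂) s
        = csiszarLeft P (fun ω => (fun i => z₂ i ω, s ω)) y₁ z₁
          + csiszarRight P (fun ω => (fun i => y₁ i ω, s ω)) y₂ z₂ + D := by
  have csiszar₁ := csiszarLeft_sub_csiszarRight (P := P) (fun ω => (fun i => z₂ i ω, s ω)) y₁ z₁
  have csiszar₂ := csiszarLeft_sub_csiszarRight (P := P) (fun ω => (fun i => y₁ i ω, s ω)) y₂ z₂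
  have left_le₁ := csiszarLeft_le (fun ω => (fun i => z₂ i ω, s ω)) y₁ z₁ hP
  have left_le₂ := csiszarLeft_le (fun ω => (fun i => y₁ i ω, s ω)) y₂ z₂ hP
  have cond_le := condEntropyOf_anti hP (fun ω i => y₁ i ω) (g := fun ω => (fun i => z₂ i ω, s ω))
    (h := s) (by simp +contextual)
  have hYY := condEntropyOf_prodMk' (P := P) (fun ω i => y₁ i ω) (fun ω i => y₂ i ω) s
  have hZZ := condEntropyOf_prodMk (P := P) (fun ω i => z₁ i ω) (fun ω i => z₂ i ω) s
  have hYZ := condEntropyOf_prodMk (P := P) (fun ω i => y₁ i ω) (fun ω i => z₂ i ω) s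
  have hYZ' := condEntropyOf_prodMk' (P := P) (fun ω i => y₁ i ω) (fun ω i => z₂ i ω) s
  refine ⟨condEntropyOf P (blockPair y₁ y₂) s
    - csiszarLeft P (fun ω => (fun i => z₂ i ω, s ω)) y₁ z₁
    - csiszarLeft P (fun ω => (fun i => y₁ i ω, s ω)) y₂ z₂,
    ?_, ?_, ?_, ?_⟩ <;> unfold blockPair <;> linarith

end Csiszar

section ConvexHull

variable {E : Type*} [AddCommGroup E] [Module ℝ E]

/-- Carathéodory's theorem with a number of points that depends only on the dimension. -/
theorem exists_stdSimplex_of_mem_convexHull [FiniteDimensional ℝ E] {s : Set E} {x : E}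
    (hx : x ∈ convexHull ℝ s) :
    ∃ w ∈ stdSimplex ℝ (Fin (Module.finrank ℝ E + 1)), ∃ z : Fin (Module.finrank ℝ E + 1) → E,
      (∀ i, z i ∈ s) ∧ ∑ i, w i • z i = x := by
  obtain ⟨ι, _, z, w, hz, hi, hw, hw1, rfl⟩ := eq_pos_convex_span_of_mem_convexHull hx
  rw [Set.range_subset_iff] at hz
  obtain ⟨e⟩ := Function.Embedding.nonempty_of_card_le
    (α := ι) (β := Fin (Module.finrank ℝ E + 1)) (by
      rw [Fintype.card_fin]
      exact hi.card_le_finrank_succ.trans (Nat.succ_le_succ (Submodule.finrank_le _)))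
  have : Nonempty ι := by
    by_contra h
    simp [not_nonempty_iff.1 h] at hw1
  refine ⟨lawOf w e, ⟨lawOf_nonneg (fun i => (hw i).le) e, (sum_lawOf w e).trans hw1⟩,
    fun j => z (Function.invFun e j), fun j => hz _, ?_⟩
  rw [sum_lawOf_smul]
  simp only [Function.leftInverse_invFun e.injective _]

theorem isCompact_convexHull [FiniteDimensional ℝ E] [TopologicalSpace E]
    [IsTopologicalAddGroup E] [ContinuousSMul ℝ E] {s : Set E} (hs : IsCompact s) :
    IsCompact (convexHull ℝ s) := by
  have convexHull_eq_image : convexHull ℝ s = (fun t : (Fin (Module.finrank ℝ E + 1) → ℝ) ×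
      (Fin (Module.finrank ℝ E + 1) → E) => ∑ i, t.1 i • t.2 i) ''
        (stdSimplex ℝ _ ×ˢ Set.univ.pi fun _ => s) := by
    refine Set.Subset.antisymm (fun x hx => ?_) ?_
    · obtain ⟨w, hw, z, hz, rfl⟩ := exists_stdSimplex_of_mem_convexHull hx
      exact ⟨(w, z), ⟨hw, fun i _ => hz i⟩, rfl⟩
    · rintro _ ⟨⟨w, z⟩, ⟨hw, hz⟩, rfl⟩
      exact (convex_convexHull ℝ s).sum_mem (fun i _ => hw.1 i) hw.2
        fun i _ => subset_convexHull ℝ s (hz i trivial)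
  rw [convexHull_eq_image]
  refine ((isCompact_stdSimplex ℝ _).prod (isCompact_univ_pi fun _ => hs)).image ?_
  fun_prop

theorem sum_mem_convexHull {ι : Type*} [Fintype ι] {s : Set E} (c : ι → ℝ) (v : ι → E)
    (hc : ∀ i, 0 ≤ c i) (hc1 : ∑ i, c i = 1) (h0 : ∀ i, c i = 0 → v i = 0)
    (hs : ∀ i, 0 < c i → (c i)⁻¹ • v i ∈ s) : ∑ i, v i ∈ convexHull ℝ s := by
  have sum_eq : ∑ i, v i = ∑ i with c i ≠ 0, c i • (c i)⁻¹ • v i := by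
    rw [Finset.sum_filter]
    refine Finset.sum_congr rfl fun i _ => ?_
    split_ifs with h
    · rw [smul_inv_smul₀ h]
    · exact h0 i (not_not.1 h)
  rw [sum_eq]
  refine (convex_convexHull ℝ s).sum_mem (fun i _ => hc i)
    (by rw [Finset.sum_filter_ne_zero, hc1]) fun i hi => subset_convexHull ℝ s (hs i ?_)
  exact (hc i).lt_of_ne' (Finset.mem_filter.1 hi).2

theorem inv_sum_smul_mem_stdSimplex {X : Type*} [Fintype X] {m : X → ℝ} (hm : ∀ x, 0 ≤ m x)
    (hm0 : 0 < ∑ x, m x) :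
    (∑ x, m x)⁻¹ • m ∈ stdSimplex ℝ X := by
  refine ⟨fun x => mul_nonneg (inv_nonneg.2 hm0.le) (hm x), ?_⟩
  simp only [Pi.smul_apply, smul_eq_mul, ← Finset.mul_sum]
  exact inv_mul_cancel₀ hm0.ne'

end ConvexHull

section EntropySets

variable {X Y Z : Type*} [Fintype Y] [Fintype Z]

namespace BroadcastChannel

/-- The channel to the first receiver. -/
noncomputable def margY (q : BroadcastChannel X Y Z) (x : X) : Y → ℝ := lawOf (q x).1 Prod.fst

/-- The channel to the second receiver. -/
noncomputable def margZ (q : BroadcastChannel X Y Z) (x : X) : Z → ℝ := lawOf (q x).1 Prod.snd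

theorem margY_nonneg (q : BroadcastChannel X Y Z) (x : X) (y : Y) : 0 ≤ q.margY x y :=
  lawOf_nonneg (q x).2.1 _ _

theorem margZ_nonneg (q : BroadcastChannel X Y Z) (x : X) (z : Z) : 0 ≤ q.margZ x z :=
  lawOf_nonneg (q x).2.1 _ _

theorem sum_margY (q : BroadcastChannel X Y Z) (x : X) : ∑ y, q.margY x y = 1 :=
  (sum_lawOf _ _).trans (q x).2.2

theorem sum_margZ (q : BroadcastChannel X Y Z) (x : X) : ∑ z, q.margZ x z = 1 :=
  (sum_lawOf _ _).trans (q x).2.2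

variable [Fintype X]

/-- The output entropies at the two receivers, in the homogeneous form of `outputEntropy`. -/
noncomputable def entropies (q : BroadcastChannel X Y Z) (m : X → ℝ) : ℝ × ℝ :=
  (outputEntropy q.margY m, outputEntropy q.margZ m)

theorem entropies_smul (q : BroadcastChannel X Y Z) (c : ℝ) (m : X → ℝ) :
    q.entropies (c • m) = c • q.entropies m := by
  simp [entropies, outputEntropy_smul q.sum_margY, outputEntropy_smul q.sum_margZ]

theorem entropies_zero (q : BroadcastChannel X Y Z) : q.entropies 0 = 0 := by
  simpa using q.entropies_smul (0 : ℝ) 0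

theorem continuous_entropies (q : BroadcastChannel X Y Z) : Continuous q.entropies := by
  unfold entropies
  fun_prop

end BroadcastChannel

/-- The data on which the information terms of one component depend: the law of the input,
followed by the pairs of conditional entropies of the two outputs given `W`, given `(U, W)` and
given `(V, W)`. -/
abbrev EntropyPoint (X : Type*) := (X → ℝ) × (ℝ × ℝ) × (ℝ × ℝ) × (ℝ × ℝ)

namespace BroadcastChannel

variable [Fintype X]

/-- The input laws with their output entropies. -/
def entropyGraph (q : BroadcastChannel X Y Z) : Set ((X → ℝ) × (ℝ × ℝ)) :=
  (fun p => (p, q.entropies p)) '' stdSimplex ℝ X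

/-- The entropy points with a constant `W`: only the laws of `(U, X)` and `(V, X)` matter, and
each of them decomposes the law of `X` as a mixture. -/
def condEntropyGraph (q : BroadcastChannel X Y Z) : Set (EntropyPoint X) :=
  {κ | κ.1 ∈ stdSimplex ℝ X ∧ κ.2.1 = q.entropies κ.1 ∧
    (κ.1, κ.2.2.1) ∈ convexHull ℝ q.entropyGraph ∧ (κ.1, κ.2.2.2) ∈ convexHull ℝ q.entropyGraph}

/-- The entropy points of the channel, for arbitrary finite `W`, `U`, `V`: the mixtures of points
with a constant `W`. -/
def entropySet (q : BroadcastChannel X Y Z) : Set (EntropyPoint X) :=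
  convexHull ℝ q.condEntropyGraph

theorem isCompact_convexHull_entropyGraph (q : BroadcastChannel X Y Z) :
    IsCompact (convexHull ℝ q.entropyGraph) :=
  isCompact_convexHull ((isCompact_stdSimplex ℝ X).image
    (continuous_id.prodMk q.continuous_entropies))

theorem isClosed_condEntropyGraph (q : BroadcastChannel X Y Z) : IsClosed q.condEntropyGraph := by
  have hull_closed := q.isCompact_convexHull_entropyGraph.isClosed
  have := q.continuous_entropies
  refine ((isClosed_stdSimplex ℝ X).preimage continuous_fst).inter
    (.inter (isClosed_eq ?_ ?_) (.inter (hull_closed.preimage ?_) (hull_closed.preimage ?_)))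
  all_goals fun_prop

theorem isCompact_condEntropyGraph (q : BroadcastChannel X Y Z) :
    IsCompact q.condEntropyGraph := by
  have hull_compact := q.isCompact_convexHull_entropyGraph.image continuous_snd
  refine ((isCompact_stdSimplex ℝ X).prod
    (((isCompact_stdSimplex ℝ X).image q.continuous_entropies).prod
      (hull_compact.prod hull_compact))).of_isClosed_subset q.isClosed_condEntropyGraph ?_
  rintro κ ⟨hp, hW, hU, hV⟩
  exact ⟨hp, ⟨_, hp, hW.symm⟩, ⟨_, hU, rfl⟩, ⟨_, hV, rfl⟩⟩

theorem isCompact_entropySet (q : BroadcastChannel X Y Z) : IsCompact q.entropySet :=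
  isCompact_convexHull q.isCompact_condEntropyGraph

theorem sum_mem_convexHull_entropyGraph {ι : Type*} [Fintype ι] (q : BroadcastChannel X Y Z)
    {m : ι → X → ℝ} (hm : ∀ i x, 0 ≤ m i x) (hm1 : ∑ i, m i ∈ stdSimplex ℝ X) :
    (∑ i, m i, ∑ i, q.entropies (m i)) ∈ convexHull ℝ q.entropyGraph := by
  rw [prod_mk_sum]
  refine sum_mem_convexHull (fun i => ∑ x, m i x) (fun i => (m i, q.entropies (m i)))
    (fun i => Finset.sum_nonneg fun x _ => hm i x) ?_ (fun i hi => ?_) fun i hi => ?_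
  · rw [Finset.sum_comm, ← hm1.2]
    simp only [Finset.sum_apply]
  · have m_eq_zero : m i = 0 := (Fintype.sum_eq_zero_iff_of_nonneg (hm i)).1 hi
    simp [m_eq_zero, entropies_zero]
  · exact ⟨_, inv_sum_smul_mem_stdSimplex (hm i) hi, by simp [entropies_smul]⟩

theorem inv_smul_mem_convexHull_entropyGraph {ι : Type*} [Fintype ι] (q : BroadcastChannel X Y Z)
    {m : ι → X → ℝ} (hm : ∀ i x, 0 ≤ m i x) {c : ℝ} (hc : c • ∑ i, m i ∈ stdSimplex ℝ X)
    (hc0 : 0 ≤ c) :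
    (c • ∑ i, m i, c • ∑ i, q.entropies (m i)) ∈ convexHull ℝ q.entropyGraph := by
  rw [Finset.smul_sum] at hc
  simpa only [entropies_smul, ← Finset.smul_sum] using
    q.sum_mem_convexHull_entropyGraph (m := fun i => c • m i)
      (fun i x => mul_nonneg hc0 (hm i x)) hc

theorem sum_mem_entropySet {ι β γ : Type*} [Fintype ι] [Fintype β] [Fintype γ]
    (q : BroadcastChannel X Y Z) {m : ι → X → ℝ} {mU : ι → β → X → ℝ} {mV : ι → γ → X → ℝ}
    (hU : ∀ i j x, 0 ≤ mU i j x) (hV : ∀ i j x, 0 ≤ mV i j x)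
    (sum_mU : ∀ i, ∑ j, mU i j = m i) (sum_mV : ∀ i, ∑ j, mV i j = m i)
    (hm1 : ∑ i, ∑ x, m i x = 1) :
    (∑ i, m i, ∑ i, q.entropies (m i), ∑ i, ∑ j, q.entropies (mU i j),
      ∑ i, ∑ j, q.entropies (mV i j)) ∈ q.entropySet := by
  have hm : ∀ i x, 0 ≤ m i x := fun i x => by
    rw [← sum_mU i, Finset.sum_apply]
    exact Finset.sum_nonneg fun j _ => hU i j x
  rw [prod_mk_sum, prod_mk_sum, prod_mk_sum]
  refine sum_mem_convexHull (fun i => ∑ x, m i x)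
    (fun i => (m i, q.entropies (m i), ∑ j, q.entropies (mU i j), ∑ j, q.entropies (mV i j)))
    (fun i => Finset.sum_nonneg fun x _ => hm i x) hm1 (fun i hi => ?_) fun i hi => ?_
  · have m_eq_zero : m i = 0 := (Fintype.sum_eq_zero_iff_of_nonneg (hm i)).1 hi
    have mU_eq_zero := (Fintype.sum_eq_zero_iff_of_nonneg (hU i)).1 ((sum_mU i).trans m_eq_zero)
    have mV_eq_zero := (Fintype.sum_eq_zero_iff_of_nonneg (hV i)).1 ((sum_mV i).trans m_eq_zero)
    simp [m_eq_zero, mU_eq_zero, mV_eq_zero, entropies_zero]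
  · have normalized := inv_sum_smul_mem_stdSimplex (hm i) hi
    have hU_mem := q.inv_smul_mem_convexHull_entropyGraph (hU i) (c := (∑ x, m i x)⁻¹)
      (by rwa [sum_mU]) (inv_nonneg.2 hi.le)
    have hV_mem := q.inv_smul_mem_convexHull_entropyGraph (hV i) (c := (∑ x, m i x)⁻¹)
      (by rwa [sum_mV]) (inv_nonneg.2 hi.le)
    rw [sum_mU] at hU_mem
    rw [sum_mV] at hV_mem
    exact ⟨normalized, (q.entropies_smul _ _).symm, hU_mem, hV_mem⟩

theorem exists_of_mem_convexHull_entropyGraph (q : BroadcastChannel X Y Z) :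
    ∃ b : ℕ, ∀ t ∈ convexHull ℝ q.entropyGraph, ∃ m : Fin b → X → ℝ, (∀ j x, 0 ≤ m j x) ∧
      ∑ j, m j = t.1 ∧ ∑ j, q.entropies (m j) = t.2 := by
  refine ⟨Module.finrank ℝ ((X → ℝ) × ℝ × ℝ) + 1, fun t ht => ?_⟩
  obtain ⟨c, hc, z, hz, rfl⟩ := exists_stdSimplex_of_mem_convexHull ht
  choose g hg hgz using hz
  refine ⟨fun j => c j • g j, fun j x => mul_nonneg (hc.1 j) ((hg j).1 x), ?_⟩
  simp only [← hgz, entropies_smul, Prod.fst_sum, Prod.snd_sum, Prod.smul_mk, and_self]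

theorem exists_of_mem_entropySet (q : BroadcastChannel X Y Z) {κ : EntropyPoint X}
    (hκ : κ ∈ q.entropySet) :
    ∃ (a b : ℕ) (m : Fin a → X → ℝ) (mU mV : Fin a → Fin b → X → ℝ),
      (∀ i j x, 0 ≤ mU i j x) ∧ (∀ i j x, 0 ≤ mV i j x) ∧
      (∀ i, ∑ j, mU i j = m i) ∧ (∀ i, ∑ j, mV i j = m i) ∧ ∑ i, ∑ x, m i x = 1 ∧
      (∑ i, m i, ∑ i, q.entropies (m i), ∑ i, ∑ j, q.entropies (mU i j),
        ∑ i, ∑ j, q.entropies (mV i j)) = κ := by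
  obtain ⟨c, hc, z, hz, rfl⟩ := exists_stdSimplex_of_mem_convexHull hκ
  obtain ⟨b, decompose⟩ := q.exists_of_mem_convexHull_entropyGraph
  choose μ hμ sum_μ entropies_μ using fun i => decompose _ (hz i).2.2.1
  choose ν hν sum_ν entropies_ν using fun i => decompose _ (hz i).2.2.2
  refine ⟨_, b, fun i => c i • (z i).1, fun i j => c i • μ i j, fun i j => c i • ν i j,
    fun i j x => mul_nonneg (hc.1 i) (hμ i j x), fun i j x => mul_nonneg (hc.1 i) (hν i j x),
    fun i => by rw [← Finset.smul_sum, sum_μ], fun i => by rw [← Finset.smul_sum, sum_ν], ?_, ?_⟩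
  · simp only [Pi.smul_apply, smul_eq_mul, ← Finset.mul_sum, (hz _).1.2, mul_one, hc.2]
  · simp only [entropies_smul, ← Finset.smul_sum, entropies_μ, entropies_ν, ← (hz _).2.1,
      Prod.ext_iff, Prod.fst_sum, Prod.snd_sum, Prod.smul_fst, Prod.smul_snd, and_self]

end BroadcastChannel

end EntropySets

section EntropyPoint

variable {Ω W U V X Y Z : Type*} [Fintype Ω] [Fintype W] [Fintype U] [Fintype V] [Fintype Y]
  [Fintype Z] {P : Ω → ℝ}

/-- The entropy point of the random variables `w`, `u`, `v`, `x` with the channel outputs `y`,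
`z`. -/
noncomputable def entropyPointOf (P : Ω → ℝ) (w : Ω → W) (u : Ω → U) (v : Ω → V) (x : Ω → X)
    (y : Ω → Y) (z : Ω → Z) : EntropyPoint X :=
  (lawOf P x, (condEntropyOf P y w, condEntropyOf P z w),
    (condEntropyOf P y fun ω => (u ω, w ω), condEntropyOf P z fun ω => (u ω, w ω)),
    (condEntropyOf P y fun ω => (v ω, w ω), condEntropyOf P z fun ω => (v ω, w ω)))

namespace IsOutput

variable {S : Type*} {q : BroadcastChannel X Y Z} {f : Ω → S} {x : Ω → X} {y : Ω → Y} {z : Ω → Z}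

theorem margY (H : IsOutput P f x (fun ω => (y ω, z ω)) fun x => (q x).1) :
    IsOutput P f x y q.margY :=
  H.comp_right Prod.fst

theorem margZ (H : IsOutput P f x (fun ω => (y ω, z ω)) fun x => (q x).1) :
    IsOutput P f x z q.margZ :=
  H.comp_right Prod.snd

theorem sum_entropies [Fintype S] [Fintype X]
    (H : IsOutput P f x (fun ω => (y ω, z ω)) fun x => (q x).1) :
    ∑ s, q.entropies (fun a => lawOf P (fun ω => (f ω, x ω)) (s, a))
      = (condEntropyOf P y f, condEntropyOf P z f) := by
  simp only [BroadcastChannel.entropies, ← prod_mk_sum, H.margY.condEntropyOf_eq_sum,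
    H.margZ.condEntropyOf_eq_sum]

end IsOutput

variable [Fintype X] {q : BroadcastChannel X Y Z} {w : Ω → W} {u : Ω → U} {v : Ω → V} {x : Ω → X}
  {y : Ω → Y} {z : Ω → Z}

theorem entropyPointOf_eq_sum
    (H : IsOutput P (fun ω => (w ω, u ω, v ω)) x (fun ω => (y ω, z ω)) fun x => (q x).1) :
    entropyPointOf P w u v x y z
      = (∑ i, fun a => lawOf P (fun ω => (w ω, x ω)) (i, a),
        ∑ i, q.entropies fun a => lawOf P (fun ω => (w ω, x ω)) (i, a),
        ∑ i, ∑ j, q.entropies fun a => lawOf P (fun ω => ((u ω, w ω), x ω)) ((j, i), a),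
        ∑ i, ∑ j, q.entropies fun a => lawOf P (fun ω => ((v ω, w ω), x ω)) ((j, i), a)) := by
  have hW := (H.comp_left Prod.fst).sum_entropies
  have hU := (H.comp_left fun t => (t.2.1, t.1)).sum_entropies
  have hV := (H.comp_left fun t => (t.2.2, t.1)).sum_entropies
  rw [Fintype.sum_prod_type_right] at hU hV
  rw [hW, hU, hV, entropyPointOf]
  congr 1
  ext a
  rw [Finset.sum_apply, sum_lawOf_prodMk_left]

theorem entropyPointOf_mem_entropySet (hP : ∀ ω, 0 ≤ P ω) (hP1 : ∑ ω, P ω = 1)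
    (H : IsOutput P (fun ω => (w ω, u ω, v ω)) x (fun ω => (y ω, z ω)) fun x => (q x).1) :
    entropyPointOf P w u v x y z ∈ q.entropySet := by
  rw [entropyPointOf_eq_sum H]
  refine q.sum_mem_entropySet (fun _ _ _ => lawOf_nonneg hP _ _) (fun _ _ _ => lawOf_nonneg hP _ _)
    (fun i => ?_) (fun i => ?_)
    (by rw [← Fintype.sum_prod_type' (f := fun i a => lawOf P (fun ω => (w ω, x ω)) (i, a)),
      sum_lawOf, hP1])
  · ext a
    rw [Finset.sum_apply, ← sum_lawOf_prodMk_left P u]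
    exact Finset.sum_congr rfl fun j _ => lawOf_congr fun ω => by simp [and_assoc]
  · ext a
    rw [Finset.sum_apply, ← sum_lawOf_prodMk_left P v]
    exact Finset.sum_congr rfl fun j _ => lawOf_congr fun ω => by simp [and_assoc]

end EntropyPoint

namespace EntropyPoint

variable {X Y Z : Type*} [Fintype X] [Fintype Y] [Fintype Z]

/-- The mutual information `I(W; Y)` at an entropy point. -/
noncomputable def infoWY (q : BroadcastChannel X Y Z) (κ : EntropyPoint X) : ℝ :=
  outputEntropy q.margY κ.1 - κ.2.1.1

/-- The mutual information `I(W; Z)` at an entropy point. -/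
noncomputable def infoWZ (q : BroadcastChannel X Y Z) (κ : EntropyPoint X) : ℝ :=
  outputEntropy q.margZ κ.1 - κ.2.1.2

/-- The conditional mutual information `I(U; Y | W)` at an entropy point. -/
def infoUY (κ : EntropyPoint X) : ℝ := κ.2.1.1 - κ.2.2.1.1

/-- The conditional mutual information `I(V; Z | W)` at an entropy point. -/
def infoVZ (κ : EntropyPoint X) : ℝ := κ.2.1.2 - κ.2.2.2.2

/-- The conditional mutual information `I(X; Z | U, W)` at an entropy point. -/
noncomputable def infoXZ (q : BroadcastChannel X Y Z) (κ : EntropyPoint X) : ℝ :=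
  κ.2.2.1.2 - noiseEntropy q.margZ κ.1

/-- The conditional mutual information `I(X; Y | V, W)` at an entropy point. -/
noncomputable def infoXY (q : BroadcastChannel X Y Z) (κ : EntropyPoint X) : ℝ :=
  κ.2.2.2.1 - noiseEntropy q.margY κ.1

end EntropyPoint

section Gluing

variable {W V U X : Type*} {mU : W → U → X → ℝ} {mV : W → V → X → ℝ}

/-- The law of `(W, V, U, X)` under which `U` and `V` are conditionally independent given
`(W, X)`, with prescribed laws `mU` of `(W, U, X)` and `mV` of `(W, V, X)` that agree on `(W, X)`.
Where the law of `(W, X)` vanishes, so does the numerator, and the quotient is `0`. -/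
noncomputable def gluedLaw [Fintype U] (mU : W → U → X → ℝ) (mV : W → V → X → ℝ) :
    W × V × U × X → ℝ :=
  fun r => mU r.1 r.2.2.1 r.2.2.2 * mV r.1 r.2.1 r.2.2.2 / ∑ u, mU r.1 u r.2.2.2

theorem gluedLaw_nonneg [Fintype U] (hU : ∀ w u x, 0 ≤ mU w u x) (hV : ∀ w v x, 0 ≤ mV w v x)
    (r : W × V × U × X) : 0 ≤ gluedLaw mU mV r :=
  div_nonneg (mul_nonneg (hU _ _ _) (hV _ _ _)) (Finset.sum_nonneg fun u _ => hU _ u _)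

theorem mul_sum_div_sum_cancel {ι : Type*} [Fintype ι] {f : ι → ℝ} (hf : ∀ i, 0 ≤ f i) (i : ι) :
    f i * (∑ j, f j) / ∑ j, f j = f i :=
  mul_div_cancel_of_imp fun h => congrFun ((Fintype.sum_eq_zero_iff_of_nonneg hf).1 h) i

variable [Fintype W] [Fintype V] [Fintype U] [Fintype X]

theorem lawOf_gluedLaw_left (hU : ∀ w u x, 0 ≤ mU w u x)
    (h : ∀ w x, ∑ u, mU w u x = ∑ v, mV w v x) (w : W) (u : U) (x : X) :
    lawOf (gluedLaw mU mV) (fun r => ((r.2.2.1, r.1), r.2.2.2)) ((u, w), x) = mU w u x := by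
  classical
  trans ∑ v, mU w u x * mV w v x / ∑ u, mU w u x
  · simp [lawOf, gluedLaw, Fintype.sum_prod_type, ite_and]
  · rw [← Finset.sum_div, ← Finset.mul_sum, ← h, mul_sum_div_sum_cancel fun u => hU w u x]

theorem lawOf_gluedLaw_right (hV : ∀ w v x, 0 ≤ mV w v x)
    (h : ∀ w x, ∑ u, mU w u x = ∑ v, mV w v x) (w : W) (v : V) (x : X) :
    lawOf (gluedLaw mU mV) (fun r => ((r.2.1, r.1), r.2.2.2)) ((v, w), x) = mV w v x := by
  classical
  trans ∑ u, mU w u x * mV w v x / ∑ u, mU w u x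
  · simp [lawOf, gluedLaw, Fintype.sum_prod_type, ite_and]
  · rw [← Finset.sum_div, ← Finset.sum_mul, h, mul_comm, mul_sum_div_sum_cancel fun v => hV w v x]

theorem lawOf_gluedLaw (hU : ∀ w u x, 0 ≤ mU w u x)
    (h : ∀ w x, ∑ u, mU w u x = ∑ v, mV w v x) (w : W) (x : X) :
    lawOf (gluedLaw mU mV) (fun r => (r.1, r.2.2.2)) (w, x) = ∑ u, mU w u x := by
  rw [← sum_lawOf_prodMk_left _ fun r => r.2.2.1]
  refine Finset.sum_congr rfl fun u _ => ?_
  rw [← lawOf_gluedLaw_left hU h]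
  exact lawOf_congr fun r => by simp [and_assoc]

end Gluing

section Realization

variable {W V U X Y Z : Type*} [Fintype W] [Fintype V] [Fintype U] [Fintype X] [Fintype Y]
  [Fintype Z]

theorem lawOf_jointLaw_input {A : Type*} (p : W × V × U × X → ℝ) (q : BroadcastChannel X Y Z)
    (f : W × V × U × X → A) (a : A) : lawOf (jointLaw p q) (fun ω => f ω.1) a = lawOf p f a := by
  unfold lawOf jointLaw
  rw [Fintype.sum_prod_type]
  refine Finset.sum_congr rfl fun r _ => ?_
  by_cases h : f r = a
  · simp only [h, if_true, ← Finset.mul_sum, (q _).2.2, mul_one]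
  · simp [h]

theorem sum_jointLaw (p : W × V × U × X → ℝ) (q : BroadcastChannel X Y Z) :
    ∑ ω, jointLaw p q ω = ∑ r, p r := by
  rw [Fintype.sum_prod_type]
  simp only [jointLaw, ← Finset.mul_sum, (q _).2.2, mul_one]

theorem isOutput_jointLaw {S : Type*} (p : W × V × U × X → ℝ) (q : BroadcastChannel X Y Z)
    (f : W × V × U × X → S) :
    IsOutput (jointLaw p q) (fun ω => f ω.1) (fun ω => ω.1.2.2.2) (fun ω => (ω.2.1, ω.2.2))
      fun x => (q x).1 :=
  isOutput_of_equiv (Q := p) (ξ := fun r => r.2.2.2) (Equiv.refl _) (fun x => (q x).2.2)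
    (fun _ => rfl) fun _ _ => congrArg f

variable (p : W × V × U × X → ℝ) (q : BroadcastChannel X Y Z)

/-- The entropy point of the law `p` of `(W, V, U, X)`. -/
noncomputable def entropyPoint : EntropyPoint X :=
  entropyPointOf (jointLaw p q) (fun ω => ω.1.1) (fun ω => ω.1.2.2.1) (fun ω => ω.1.2.1)
    (fun ω => ω.1.2.2.2) (fun ω => ω.2.1) (fun ω => ω.2.2)

theorem infoWY_eq (hp : ∑ r, p r = 1) : infoWY p q = (entropyPoint p q).infoWY q := by
  rw [infoWY, mutInfo_eq_sub, ((isOutput_jointLaw p q Prod.fst).margY).entropyOf_eq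
    ((sum_jointLaw p q).trans hp)]
  rfl

theorem infoWZ_eq (hp : ∑ r, p r = 1) : infoWZ p q = (entropyPoint p q).infoWZ q := by
  rw [infoWZ, mutInfo_eq_sub, ((isOutput_jointLaw p q Prod.fst).margZ).entropyOf_eq
    ((sum_jointLaw p q).trans hp)]
  rfl

theorem infoUY_eq : infoUY p q = (entropyPoint p q).infoUY := by
  rw [infoUY, condMutInfo_eq_sub]
  rfl

theorem infoVZ_eq : infoVZ p q = (entropyPoint p q).infoVZ := by
  rw [infoVZ, condMutInfo_eq_sub]
  rfl

theorem infoXZ_eq : infoXZ p q = (entropyPoint p q).infoXZ q := by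
  rw [infoXZ, condMutInfo_eq_sub, (isOutput_jointLaw p q fun r =>
    (r.2.2.2, r.2.2.1, r.1)).margZ.condEntropyOf_eq_noiseEntropy q.sum_margZ (φ := Prod.fst)
      fun _ => rfl]
  rfl

theorem infoXY_eq : infoXY p q = (entropyPoint p q).infoXY q := by
  rw [infoXY, condMutInfo_eq_sub, (isOutput_jointLaw p q fun r =>
    (r.2.2.2, r.2.1, r.1)).margY.condEntropyOf_eq_noiseEntropy q.sum_margY (φ := Prod.fst)
      fun _ => rfl]
  rfl

theorem entropyPoint_eq_sum : entropyPoint p q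
    = (∑ i, fun a => lawOf p (fun r => (r.1, r.2.2.2)) (i, a),
      ∑ i, q.entropies fun a => lawOf p (fun r => (r.1, r.2.2.2)) (i, a),
      ∑ i, ∑ j, q.entropies fun a => lawOf p (fun r => ((r.2.2.1, r.1), r.2.2.2)) ((j, i), a),
      ∑ i, ∑ j, q.entropies fun a => lawOf p (fun r => ((r.2.1, r.1), r.2.2.2)) ((j, i), a)) := by
  rw [entropyPoint, entropyPointOf_eq_sum (isOutput_jointLaw p q fun r => (r.1, r.2.2.1, r.2.1))]
  simp only [lawOf_jointLaw_input p q fun r => (r.1, r.2.2.2),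
    lawOf_jointLaw_input p q fun r => ((r.2.2.1, r.1), r.2.2.2),
    lawOf_jointLaw_input p q fun r => ((r.2.1, r.1), r.2.2.2)]

theorem exists_entropyPoint_eq {q : BroadcastChannel X Y Z} {κ : EntropyPoint X}
    (hκ : κ ∈ q.entropySet) : ∃ a b c : ℕ,
      ∃ p ∈ stdSimplex ℝ (Fin a × Fin b × Fin c × X), entropyPoint p q = κ := by
  obtain ⟨a, b, m, mU, mV, hU, hV, sum_mU, sum_mV, hm1, rfl⟩ := q.exists_of_mem_entropySet hκ
  have sum_mU_apply (i x) : ∑ j, mU i j x = m i x := by rw [← sum_mU, Finset.sum_apply]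
  have sum_eq (i x) : ∑ j, mU i j x = ∑ j, mV i j x := by
    rw [sum_mU_apply, ← sum_mV, Finset.sum_apply]
  refine ⟨a, b, b, gluedLaw mU mV, ⟨gluedLaw_nonneg hU hV, ?_⟩, ?_⟩
  · rw [← sum_lawOf _ fun r => (r.1, r.2.2.2), Fintype.sum_prod_type, ← hm1]
    simp only [lawOf_gluedLaw hU sum_eq, sum_mU_apply]
  · simp only [entropyPoint_eq_sum, lawOf_gluedLaw hU sum_eq, lawOf_gluedLaw_left hU sum_eq,
      lawOf_gluedLaw_right hV sum_eq, sum_mU_apply]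

end Realization

section EntropyOuterBound

namespace EntropyPoint

variable {X Y Z : Type*}

@[fun_prop]
theorem continuous_infoUY : Continuous (infoUY (X := X)) := by
  unfold infoUY
  fun_prop

@[fun_prop]
theorem continuous_infoVZ : Continuous (infoVZ (X := X)) := by
  unfold infoVZ
  fun_prop

variable [Fintype X] [Fintype Y] [Fintype Z] (q : BroadcastChannel X Y Z)

@[fun_prop]
theorem continuous_infoWY : Continuous (infoWY q) := by
  unfold infoWY
  fun_prop

@[fun_prop]
theorem continuous_infoWZ : Continuous (infoWZ q) := by
  unfold infoWZ
  fun_prop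

@[fun_prop]
theorem continuous_infoXZ : Continuous (infoXZ q) := by
  unfold infoXZ
  fun_prop

@[fun_prop]
theorem continuous_infoXY : Continuous (infoXY q) := by
  unfold infoXY
  fun_prop

theorem fst_mem_stdSimplex {q : BroadcastChannel X Y Z} {κ : EntropyPoint X}
    (hκ : κ ∈ q.entropySet) : κ.1 ∈ stdSimplex ℝ X :=
  convexHull_min (fun _ h => h.1) ((convex_stdSimplex ℝ X).linear_preimage
    (LinearMap.fst ℝ (X → ℝ) ((ℝ × ℝ) × (ℝ × ℝ) × (ℝ × ℝ)))) hκ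

/-- Time sharing: `I(W; Y)` and `I(W; Z)` are concave on the entropy set, and the remaining
information terms are linear. -/
theorem exists_average {n : ℕ} (hn : 0 < n) {κ : Fin n → EntropyPoint X}
    (hκ : ∀ i, κ i ∈ q.entropySet) : ∃ κ' ∈ q.entropySet,
      ∑ i, infoWY q (κ i) ≤ n * infoWY q κ' ∧ ∑ i, infoWZ q (κ i) ≤ n * infoWZ q κ' ∧
      ∑ i, infoUY (κ i) = n * infoUY κ' ∧ ∑ i, infoVZ (κ i) = n * infoVZ κ' ∧
      ∑ i, infoXZ q (κ i) = n * infoXZ q κ' ∧ ∑ i, infoXY q (κ i) = n * infoXY q κ' := by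
  have hn' : (n : ℝ) ≠ 0 := by positivity
  have weight_nonneg : ∀ i ∈ (Finset.univ : Finset (Fin n)), (0 : ℝ) ≤ (n : ℝ)⁻¹ :=
    fun _ _ => by positivity
  have sum_weight : ∑ _i : Fin n, (n : ℝ)⁻¹ = 1 := by simp [hn']
  refine ⟨∑ i, (n : ℝ)⁻¹ • κ i,
    (convex_convexHull ℝ _).sum_mem weight_nonneg sum_weight fun i _ => hκ i, ?_⟩
  have jensenY := (concaveOn_outputEntropy q.margY_nonneg).le_map_sum weight_nonneg sum_weight
    fun i _ => fst_mem_stdSimplex (hκ i)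
  have jensenZ := (concaveOn_outputEntropy q.margZ_nonneg).le_map_sum weight_nonneg sum_weight
    fun i _ => fst_mem_stdSimplex (hκ i)
  have noiseY := noiseEntropy_sum_smul (k := q.margY) Finset.univ (fun _ => (n : ℝ)⁻¹)
    fun i => (κ i).1
  have noiseZ := noiseEntropy_sum_smul (k := q.margZ) Finset.univ (fun _ => (n : ℝ)⁻¹)
    fun i => (κ i).1
  simp only [← Finset.smul_sum, smul_eq_mul, ← Finset.mul_sum] at jensenY jensenZ noiseY noiseZ ⊢
  rw [inv_mul_le_iff₀ (by positivity)] at jensenY jensenZ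
  simp only [infoWY, infoWZ, infoUY, infoVZ, infoXZ, infoXY, Prod.smul_fst, Prod.smul_snd,
    Prod.fst_sum, Prod.snd_sum, Finset.sum_sub_distrib, noiseY, noiseZ, smul_eq_mul, mul_sub,
    mul_inv_cancel_left₀ hn', and_self, and_true]
  exact ⟨sub_le_sub_right jensenY _, sub_le_sub_right jensenZ _⟩

end EntropyPoint

open EntropyPoint

variable {X₁ Y₁ Z₁ X₂ Y₂ Z₂ : Type*} [Fintype X₁] [Fintype Y₁] [Fintype Z₁] [Fintype X₂]
  [Fintype Y₂] [Fintype Z₂] (q₁ : BroadcastChannel X₁ Y₁ Z₁) (q₂ : BroadcastChannel X₂ Y₂ Z₂)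

/-- The counterpart of `commonTerm` for entropy points. -/
noncomputable def EntropyPoint.commonTerm (κ₁ : EntropyPoint X₁) (κ₂ : EntropyPoint X₂) : ℝ :=
  min (infoWY q₁ κ₁ + infoWY q₂ κ₂) (infoWZ q₁ κ₁ + infoWZ q₂ κ₂)

/-- The triples allowed by the five inequalities at given entropy points of the components. -/
def entropyRegion (κ₁ : EntropyPoint X₁) (κ₂ : EntropyPoint X₂) : Set (ℝ × ℝ × ℝ) :=
  {R | R.1 ≤ commonTerm q₁ q₂ κ₁ κ₂ ∧
    R.1 + R.2.1 ≤ commonTerm q₁ q₂ κ₁ κ₂ + infoUY κ₁ + infoUY κ₂ ∧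
    R.1 + R.2.2 ≤ commonTerm q₁ q₂ κ₁ κ₂ + infoVZ κ₁ + infoVZ κ₂ ∧
    R.1 + R.2.1 + R.2.2 ≤ commonTerm q₁ q₂ κ₁ κ₂
      + infoUY κ₂ + infoXZ q₂ κ₂ + min (infoUY κ₁ + infoXZ q₁ κ₁) (infoVZ κ₁ + infoXY q₁ κ₁) ∧
    R.1 + R.2.1 + R.2.2 ≤ commonTerm q₁ q₂ κ₁ κ₂
      + min (infoUY κ₂ + infoXZ q₂ κ₂) (infoVZ κ₂ + infoXY q₂ κ₂) + infoVZ κ₁ + infoXY q₁ κ₁}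

theorem isClosed_entropyRegion_graph :
    IsClosed {t : (EntropyPoint X₁ × EntropyPoint X₂) × (ℝ × ℝ × ℝ) |
      t.2 ∈ entropyRegion q₁ q₂ t.1.1 t.1.2} := by
  simp only [entropyRegion, EntropyPoint.commonTerm, Set.ofPred_and]
  refine .inter ?_ (.inter ?_ (.inter ?_ (.inter ?_ ?_)))
  all_goals exact isClosed_le (by fun_prop) (by fun_prop)

/-- The outer bound in terms of the entropy sets. -/
def entropyOuterBound : Set (ℝ × ℝ × ℝ) :=
  {R | ∃ κ₁ ∈ q₁.entropySet, ∃ κ₂ ∈ q₂.entropySet, R ∈ entropyRegion q₁ q₂ κ₁ κ₂}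

theorem isClosed_entropyOuterBound : IsClosed (entropyOuterBound q₁ q₂) := by
  have := isCompact_iff_compactSpace.1 q₁.isCompact_entropySet
  have := isCompact_iff_compactSpace.1 q₂.isCompact_entropySet
  have eq_image_snd : entropyOuterBound q₁ q₂ = Prod.snd ''
      {t : (q₁.entropySet × q₂.entropySet) × (ℝ × ℝ × ℝ) |
        t.2 ∈ entropyRegion q₁ q₂ t.1.1 t.1.2} := by
    ext R
    constructor
    · rintro ⟨κ₁, h₁, κ₂, h₂, h⟩
      exact ⟨((⟨κ₁, h₁⟩, ⟨κ₂, h₂⟩), R), h, rfl⟩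
    · rintro ⟨⟨⟨κ₁, κ₂⟩, R⟩, h, rfl⟩
      exact ⟨κ₁, κ₁.2, κ₂, κ₂.2, h⟩
  rw [eq_image_snd]
  exact isClosedMap_snd_of_compactSpace _
    ((isClosed_entropyRegion_graph q₁ q₂).preimage (by fun_prop :
      Continuous fun t : (q₁.entropySet × q₂.entropySet) × (ℝ × ℝ × ℝ) =>
        ((t.1.1.1, t.1.2.1), t.2)))

theorem entropyOuterBound_subset_productOuterBound :
    entropyOuterBound q₁ q₂ ⊆ productOuterBound q₁ q₂ := by
  rintro R ⟨κ₁, h₁, κ₂, h₂, hR⟩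
  obtain ⟨a₁, b₁, c₁, p₁, hp₁, rfl⟩ := exists_entropyPoint_eq h₁
  obtain ⟨a₂, b₂, c₂, p₂, hp₂, rfl⟩ := exists_entropyPoint_eq h₂
  refine ⟨a₁, b₁, c₁, a₂, b₂, c₂, p₁, hp₁, p₂, hp₂, ?_⟩
  simpa only [regionOf, entropyRegion, _root_.commonTerm, EntropyPoint.commonTerm,
    infoWY_eq _ _ hp₁.2, infoWY_eq _ _ hp₂.2,
    infoWZ_eq _ _ hp₁.2, infoWZ_eq _ _ hp₂.2, infoUY_eq, infoVZ_eq, infoXZ_eq, infoXY_eq]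
    using hR

end EntropyOuterBound

section Memoryless

variable {Ω R S O X : Type*} [Fintype Ω] {P : Ω → ℝ} {n : ℕ}

/-- `o` consists of the outputs of `n` uses of the kernel `k` with inputs `x`, without memory and
without feedback: each output depends on the variable `s` and on the other outputs only through
its own input. -/
def IsMemorylessOutput (P : Ω → ℝ) (s : Ω → S) (x : Fin n → Ω → X) (o : Fin n → Ω → O)
    (k : X → O → ℝ) : Prop :=
  ∀ i, IsOutput P (fun ω => (s ω, fun j : {j // j ≠ i} => o j ω)) (x i) (o i) k

theorem isMemorylessOutput_of_equiv [Fintype O] [Finite R] (e : Ω ≃ R × (Fin n → O)) {Q : R → ℝ}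
    {ξ : Fin n → R → X} {κ : X → O → ℝ} (hκ : ∀ x, ∑ o, κ x o = 1)
    (hP : ∀ ω, P ω = Q (e ω).1 * ∏ i, κ (ξ i (e ω).1) ((e ω).2 i)) (f : R → S) :
    IsMemorylessOutput P (fun ω => f (e ω).1) (fun i ω => ξ i (e ω).1) (fun i ω => (e ω).2 i)
      κ := by
  intro i
  let e' : Ω ≃ (R × ({j // j ≠ i} → O)) × O :=
    e.trans (((Equiv.refl R).prodCongr ((Equiv.funSplitAt i O).trans (Equiv.prodComm _ _))).trans
      (Equiv.prodAssoc _ _ _).symm)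
  refine isOutput_of_equiv e'
    (Q := fun t => Q t.1 * ∏ j : {j // j ≠ i}, κ (ξ j t.1) (t.2 j)) (ξ := fun t => ξ i t.1) hκ
    (fun ω => ?_) fun ω ω' h => ?_
  · rw [hP, Fintype.prod_eq_mul_prod_subtype_ne _ i, mul_comm (κ _ _), ← mul_assoc]
    rfl
  · exact congrArg (fun t : R × ({j // j ≠ i} → O) => (f t.1, t.2)) h

variable {A B : Type*} {s : Ω → S} {x : Fin n → Ω → X} {a : Fin n → Ω → A} {b : Fin n → Ω → B}
  {k : X → A × B → ℝ}

theorem IsMemorylessOutput.isOutput_pastFuture [Finite S] [Finite A] [Finite B]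
    (H : IsMemorylessOutput P s x (fun i ω => (a i ω, b i ω)) k) (i : Fin n) :
    IsOutput P (pastFuture s a b i (i + 1)) (x i) (fun ω => (a i ω, b i ω)) k :=
  (H i).comp_left fun t => (t.1, fun l : {l : Fin n // l.1 < i} => (t.2 ⟨l.1, by grind⟩).1,
    fun l : {l : Fin n // i + 1 ≤ l.1} => (t.2 ⟨l.1, by grind⟩).2)

theorem condEntropyOf_prodMk_pastFuture {C T U W : Type*} [Fintype A] [Fintype B] [Fintype C]
    [Fintype T] [Fintype U] [Fintype W] (c : Ω → C) (t : Ω → T) (u : Ω → U) (w : Ω → W)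
    (i j : ℕ) :
    condEntropyOf P c (fun ω => (u ω, pastFuture (fun ω => (t ω, w ω)) a b i j ω))
      = condEntropyOf P c (pastFuture (fun ω => (t ω, u ω, w ω)) a b i j) :=
  condEntropyOf_congr_right c fun ω ω' => by
    simp only [Prod.mk.injEq, pastFuture_eq_iff]
    tauto

end Memoryless

namespace EntropyPoint

variable {Ω T W U V X Y Z : Type*} [Fintype Ω] [Fintype T] [Fintype W] [Fintype U] [Fintype V]
  [Fintype X] [Fintype Y] [Fintype Z] {q : BroadcastChannel X Y Z} {P : Ω → ℝ} {n : ℕ}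
  {t : Ω → T} {w : Ω → W} {u : Ω → U} {v : Ω → V} {x : Fin n → Ω → X} {y : Fin n → Ω → Y}
  {z : Fin n → Ω → Z}

/-- Single-letterization of one component with the side information `t`: the auxiliary variable
`W` of the letter `i` consists of `t`, `w`, the past of `y` and the future of `z`. -/
theorem exists_singleLetter (hP : ∀ ω, 0 ≤ P ω) (hP1 : ∑ ω, P ω = 1) (hn : 0 < n)
    (H : IsMemorylessOutput P (fun ω => (t ω, u ω, v ω, w ω)) x (fun i ω => (y i ω, z i ω))
      fun x => (q x).1)
    {φ : Fin n → U × V × W → X} (hφ : ∀ i ω, x i ω = φ i (u ω, v ω, w ω)) :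
    ∃ κ ∈ q.entropySet,
      entropyOf P (fun ω i => y i ω) - csiszarLeft P (fun ω => (t ω, w ω)) y z
        ≤ n * infoWY q κ ∧
      entropyOf P (fun ω i => z i ω) - csiszarRight P (fun ω => (t ω, w ω)) y z
        ≤ n * infoWZ q κ ∧
      csiszarLeft P (fun ω => (t ω, w ω)) y z - csiszarLeft P (fun ω => (t ω, u ω, w ω)) y z
        = n * infoUY κ ∧
      csiszarRight P (fun ω => (t ω, w ω)) y z - csiszarRight P (fun ω => (t ω, v ω, w ω)) y z
        = n * infoVZ κ ∧
      csiszarRight P (fun ω => (t ω, u ω, w ω)) y z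
        - csiszarRight P (fun ω => (t ω, u ω, v ω, w ω)) y z = n * infoXZ q κ ∧
      csiszarLeft P (fun ω => (t ω, v ω, w ω)) y z
        - csiszarLeft P (fun ω => (t ω, u ω, v ω, w ω)) y z = n * infoXY q κ := by
  have outputs (i : Fin n) := H.isOutput_pastFuture i
  have letter_mem (i : Fin n) := entropyPointOf_mem_entropySet hP hP1 (w := pastFuture
    (fun ω => (t ω, w ω)) y z i (i + 1)) (u := u) (v := v)
    ((outputs i).comp_left fun r => (((r.1.1, r.1.2.2.2), r.2), r.1.2.1, r.1.2.2.1))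
  obtain ⟨κ, hκ, hWY, hWZ, hUY, hVZ, hXZ, hXY⟩ := exists_average q hn letter_mem
  have entropyY (i : Fin n) := (outputs i).margY.entropyOf_eq hP1
  have entropyZ (i : Fin n) := (outputs i).margZ.entropyOf_eq hP1
  have noiseY (i : Fin n) := (outputs i).margY.condEntropyOf_eq_noiseEntropy q.sum_margY
    (φ := fun r => φ i r.1.2) (hφ i)
  have noiseZ (i : Fin n) := (outputs i).margZ.condEntropyOf_eq_noiseEntropy q.sum_margZ
    (φ := fun r => φ i r.1.2) (hφ i)
  simp only [infoWY, infoWZ, infoUY, infoVZ, infoXZ, infoXY, entropyPointOf, ← entropyY,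
    ← entropyZ, ← noiseY, ← noiseZ, condEntropyOf_prodMk_pastFuture,
    Finset.sum_sub_distrib] at hWY hWZ hUY hVZ hXZ hXY
  exact ⟨κ, hκ, (sub_le_sub_right (entropyOf_pi_le y hP hP1) _).trans hWY,
    (sub_le_sub_right (entropyOf_pi_le z hP hP1) _).trans hWZ, hUY, hVZ, hXZ, hXY⟩

end EntropyPoint

namespace EntropyPoint

variable {Ω U V W X₁ Y₁ Z₁ X₂ Y₂ Z₂ : Type*} [Fintype Ω] [Fintype U] [Fintype V] [Fintype W]
  [Fintype X₁] [Fintype Y₁] [Fintype Z₁] [Fintype X₂] [Fintype Y₂] [Fintype Z₂]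
  {q₁ : BroadcastChannel X₁ Y₁ Z₁} {q₂ : BroadcastChannel X₂ Y₂ Z₂} {P : Ω → ℝ} {n : ℕ}
  {u : Ω → U} {v : Ω → V} {w : Ω → W}
  {x₁ : Fin n → Ω → X₁} {y₁ : Fin n → Ω → Y₁} {z₁ : Fin n → Ω → Z₁}
  {x₂ : Fin n → Ω → X₂} {y₂ : Fin n → Ω → Y₂} {z₂ : Fin n → Ω → Z₂}

/-- The last bound pairs the terms `I(V;Z|W) + I(X;Y|V,W)` of the first component with the terms
`I(U;Y|W) + I(X;Z|U,W)` of the second one; its left-hand side involves the mixed outputs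
`(y₁ⁿ, z₂ⁿ)`, which no receiver observes. -/
theorem exists_singleLetter_bounds (hP : ∀ ω, 0 ≤ P ω) (hP1 : ∑ ω, P ω = 1) (hn : 0 < n)
    (H₁ : IsMemorylessOutput P (fun ω => (fun i => z₂ i ω, u ω, v ω, w ω)) x₁
      (fun i ω => (y₁ i ω, z₁ i ω)) fun x => (q₁ x).1)
    (H₂ : IsMemorylessOutput P (fun ω => (fun i => y₁ i ω, u ω, v ω, w ω)) x₂
      (fun i ω => (y₂ i ω, z₂ i ω)) fun x => (q₂ x).1)
    {φ₁ : Fin n → U × V × W → X₁} (hφ₁ : ∀ i ω, x₁ i ω = φ₁ i (u ω, v ω, w ω))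
    {φ₂ : Fin n → U × V × W → X₂} (hφ₂ : ∀ i ω, x₂ i ω = φ₂ i (u ω, v ω, w ω))
    {c : ℝ} (hcY : c ≤ mutInfo P w (blockPair y₁ y₂)) (hcZ : c ≤ mutInfo P w (blockPair z₁ z₂)) :
    ∃ κ₁ ∈ q₁.entropySet, ∃ κ₂ ∈ q₂.entropySet,
      c ≤ n * commonTerm q₁ q₂ κ₁ κ₂ ∧
      c + condMutInfo P u (blockPair y₁ y₂) w
        ≤ n * (commonTerm q₁ q₂ κ₁ κ₂ + infoUY κ₁ + infoUY κ₂) ∧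
      c + condMutInfo P v (blockPair z₁ z₂) w
        ≤ n * (commonTerm q₁ q₂ κ₁ κ₂ + infoVZ κ₁ + infoVZ κ₂) ∧
      c + condMutInfo P u (blockPair y₁ y₂) w
          + condMutInfo P v (blockPair z₁ z₂) (fun ω => (u ω, w ω))
        ≤ n * (commonTerm q₁ q₂ κ₁ κ₂ + infoUY κ₂ + infoXZ q₂ κ₂
          + (infoUY κ₁ + infoXZ q₁ κ₁)) ∧
      c + condMutInfo P v (blockPair z₁ z₂) w
          + condMutInfo P u (blockPair y₁ y₂) (fun ω => (v ω, w ω))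
        ≤ n * (commonTerm q₁ q₂ κ₁ κ₂ + (infoVZ κ₂ + infoXY q₂ κ₂)
          + infoVZ κ₁ + infoXY q₁ κ₁) ∧
      c + condMutInfo P u (blockPair y₁ y₂) w + condMutInfo P v (blockPair z₁ z₂) w
          + (condMutInfo P u (blockPair y₁ z₂) (fun ω => (v ω, w ω))
            - condMutInfo P u (blockPair y₁ z₂) w)
        ≤ n * (commonTerm q₁ q₂ κ₁ κ₂ + infoUY κ₂ + infoXZ q₂ κ₂
          + (infoVZ κ₁ + infoXY q₁ κ₁)) := by
  obtain ⟨κ₁, hκ₁, WY₁, WZ₁, UY₁, VZ₁, XZ₁, XY₁⟩ := exists_singleLetter hP hP1 hn H₁ hφ₁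
  obtain ⟨κ₂, hκ₂, WY₂, WZ₂, UY₂, VZ₂, XZ₂, XY₂⟩ := exists_singleLetter hP hP1 hn H₂ hφ₂
  obtain ⟨D, hD, YD, ZD, TD⟩ := exists_csiszar_defect hP w y₁ z₁ y₂ z₂
  obtain ⟨Du, hDu, YDu, ZDu, TDu⟩ :=
    exists_csiszar_defect hP (fun ω => (u ω, w ω)) y₁ z₁ y₂ z₂
  obtain ⟨Dv, hDv, YDv, ZDv, TDv⟩ :=
    exists_csiszar_defect hP (fun ω => (v ω, w ω)) y₁ z₁ y₂ z₂
  obtain ⟨Duv, hDuv, YDuv, ZDuv, TDuv⟩ :=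
    exists_csiszar_defect hP (fun ω => (u ω, v ω, w ω)) y₁ z₁ y₂ z₂
  have hcommon : c + D ≤ n * commonTerm q₁ q₂ κ₁ κ₂ := by
    have hY := entropyOf_blockPair_le y₁ y₂ hP hP1
    have hZ := entropyOf_blockPair_le z₁ z₂ hP hP1
    rw [mutInfo_eq_sub] at hcY hcZ
    rw [commonTerm, mul_min_of_nonneg _ _ n.cast_nonneg, le_min_iff]
    constructor <;> linarith
  have swap : condEntropyOf P (blockPair z₁ z₂) (fun ω => (v ω, u ω, w ω))
      = condEntropyOf P (blockPair z₁ z₂) fun ω => (u ω, v ω, w ω) :=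
    condEntropyOf_congr_right _ fun ω ω' => by simp; tauto
  simp only [condMutInfo_eq_sub, swap]
  refine ⟨κ₁, hκ₁, κ₂, hκ₂, ?_, ?_, ?_, ?_, ?_, ?_⟩ <;> linarith

theorem exists_mem_entropyRegion (hP : ∀ ω, 0 ≤ P ω) (hP1 : ∑ ω, P ω = 1) (hn : 0 < n)
    (H₁ : IsMemorylessOutput P (fun ω => (fun i => z₂ i ω, u ω, v ω, w ω)) x₁
      (fun i ω => (y₁ i ω, z₁ i ω)) fun x => (q₁ x).1)
    (H₂ : IsMemorylessOutput P (fun ω => (fun i => y₁ i ω, u ω, v ω, w ω)) x₂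
      (fun i ω => (y₂ i ω, z₂ i ω)) fun x => (q₂ x).1)
    {φ₁ : Fin n → U × V × W → X₁} (hφ₁ : ∀ i ω, x₁ i ω = φ₁ i (u ω, v ω, w ω))
    {φ₂ : Fin n → U × V × W → X₂} (hφ₂ : ∀ i ω, x₂ i ω = φ₂ i (u ω, v ω, w ω))
    (indep : condMutInfo P u v w = 0) {R : ℝ × ℝ × ℝ}
    (h₀Y : n * R.1 ≤ mutInfo P w (blockPair y₁ y₂))
    (h₀Z : n * R.1 ≤ mutInfo P w (blockPair z₁ z₂))
    (h₁ : n * R.2.1 ≤ condMutInfo P u (blockPair y₁ y₂) w)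
    (h₂ : n * R.2.2 ≤ condMutInfo P v (blockPair z₁ z₂) w) :
    ∃ κ₁ ∈ q₁.entropySet, ∃ κ₂ ∈ q₂.entropySet, R ∈ entropyRegion q₁ q₂ κ₁ κ₂ := by
  obtain ⟨κ₁, hκ₁, κ₂, hκ₂, b₀, b₁, b₂, b₃, b₄, b₅⟩ :=
    exists_singleLetter_bounds hP hP1 hn H₁ H₂ hφ₁ hφ₂ h₀Y h₀Z
  have indep_v : condEntropyOf P v (fun ω => (u ω, w ω)) = condEntropyOf P v w :=
    (sub_eq_zero.1 ((condMutInfo_eq_sub u v w).symm.trans indep)).symm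
  have indep_u : condEntropyOf P u (fun ω => (v ω, w ω)) = condEntropyOf P u w :=
    (sub_eq_zero.1 ((condMutInfo_eq_sub' u v w).symm.trans indep)).symm
  have hY := condMutInfo_le_condMutInfo_prodMk hP u (blockPair y₁ y₂) w v indep_u
  have hZ := condMutInfo_le_condMutInfo_prodMk hP v (blockPair z₁ z₂) w u indep_v
  have hT := condMutInfo_le_condMutInfo_prodMk hP u (blockPair y₁ z₂) w v indep_u
  have cancel {a b : ℝ} (h : n * a ≤ n * b) : a ≤ b :=
    le_of_mul_le_mul_left h (by exact_mod_cast hn)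
  refine ⟨κ₁, hκ₁, κ₂, hκ₂, cancel b₀, cancel (by linarith), cancel (by linarith), ?_, ?_⟩
  · rw [← min_add_add_left]
    exact le_min (cancel (by linarith)) (cancel (by linarith))
  · rw [← min_add_add_left, ← min_add_add_right, ← min_add_add_right]
    exact le_min (cancel (by linarith)) (cancel (by linarith))

end EntropyPoint

section Uniform

variable {Ω A B C : Type*} [Fintype Ω] [Fintype A] [Fintype B] [Fintype C] {P : Ω → ℝ}

/-- The random variable `f` is uniformly distributed on its alphabet. -/
def IsUniform (P : Ω → ℝ) (f : Ω → A) : Prop :=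
  ∀ a, lawOf P f a = 1 / Fintype.card A

namespace IsUniform

theorem equiv {f : Ω → A} (h : IsUniform P f) (e : A ≃ B) : IsUniform P fun ω => e (f ω) :=
  fun b => by
    rw [← Fintype.card_congr e, ← h (e.symm b)]
    exact lawOf_congr fun ω => (e.eq_symm_apply).symm

theorem fst [Nonempty B] {f : Ω → A} {g : Ω → B} (h : IsUniform P fun ω => (f ω, g ω)) :
    IsUniform P f := fun a => by
  rw [← sum_lawOf_prodMk P f g, Finset.sum_congr rfl fun b _ => h (a, b)]
  simp only [Finset.sum_const, Finset.card_univ, nsmul_eq_mul, Fintype.card_prod, Nat.cast_mul]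
  field_simp

theorem swap {f : Ω → A} {g : Ω → B} (h : IsUniform P fun ω => (f ω, g ω)) :
    IsUniform P fun ω => (g ω, f ω) :=
  h.equiv (Equiv.prodComm A B)

theorem condEntropyOf_eq [Nonempty A] [Nonempty B] {f : Ω → A} {g : Ω → B}
    (h : IsUniform P fun ω => (f ω, g ω)) :
    condEntropyOf P f g = Real.logb 2 (Fintype.card A) := by
  rw [condEntropyOf, entropyOf_uniform h, entropyOf_uniform h.swap.fst, Fintype.card_prod,
    Nat.cast_mul, Real.logb_mul (by positivity) (by positivity), add_sub_cancel_right]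

theorem condMutInfo_eq_zero [Nonempty A] [Nonempty B] [Nonempty C] {f : Ω → A} {g : Ω → B}
    {k : Ω → C} (h : IsUniform P fun ω => (f ω, g ω, k ω)) : condMutInfo P f g k = 0 := by
  have h' : IsUniform P fun ω => ((f ω, k ω), g ω) :=
    h.equiv (((Equiv.refl A).prodCongr (Equiv.prodComm B C)).trans (Equiv.prodAssoc A C B).symm)
  rw [condMutInfo_eq_sub', h.condEntropyOf_eq, h'.fst.condEntropyOf_eq, sub_self]

end IsUniform

end Uniform

section Codes

variable {X₁ Y₁ Z₁ X₂ Y₂ Z₂ : Type*} [Fintype Y₁] [Fintype Z₁] [Fintype Y₂] [Fintype Z₂]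
  {n K₀ K₁ K₂ : ℕ}

/-- The sample space of a block code over a product channel: the messages, the outputs of the
first component channel and the outputs of the second one. -/
abbrev CodeSpace (Y₁ Z₁ Y₂ Z₂ : Type*) (n K₀ K₁ K₂ : ℕ) : Type _ :=
  (Fin K₀ × Fin K₁ × Fin K₂) × (Fin n → Y₁ × Z₁) × (Fin n → Y₂ × Z₂)

theorem sum_prod_stdSimplex {A : Type*} [Fintype A] (p : Fin n → stdSimplex ℝ A) :
    ∑ a : Fin n → A, ∏ i, (p i).1 (a i) = 1 := by
  classical
  rw [← Fintype.piFinset_univ, ← Finset.prod_univ_sum]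
  simp only [(p _).2.2, Finset.prod_const_one]

/-- Regroups the outputs of the two receivers of a product channel by component channel. -/
def componentOutputs (Y₁ Z₁ Y₂ Z₂ : Type*) (n : ℕ) :
    (Fin n → Y₁ × Y₂) × (Fin n → Z₁ × Z₂) ≃ (Fin n → Y₁ × Z₁) × (Fin n → Y₂ × Z₂) where
  toFun t := (fun i => ((t.1 i).1, (t.2 i).1), fun i => ((t.1 i).2, (t.2 i).2))
  invFun t := (fun i => ((t.1 i).1, (t.2 i).1), fun i => ((t.1 i).2, (t.2 i).2))
  left_inv _ := rfl
  right_inv _ := rfl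

namespace BroadcastCode

/-- The joint law of the uniform messages and the outputs of the two component channels. -/
noncomputable def law (q₁ : BroadcastChannel X₁ Y₁ Z₁) (q₂ : BroadcastChannel X₂ Y₂ Z₂)
    (c : BroadcastCode (X₁ × X₂) (Y₁ × Y₂) (Z₁ × Z₂) n K₀ K₁ K₂)
    (ω : CodeSpace Y₁ Z₁ Y₂ Z₂ n K₀ K₁ K₂) : ℝ :=
  ((K₀ : ℝ) * K₁ * K₂)⁻¹ * ((∏ i, (q₁ (c.enc ω.1.1 ω.1.2.1 ω.1.2.2 i).1).1 (ω.2.1 i))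
    * ∏ i, (q₂ (c.enc ω.1.1 ω.1.2.1 ω.1.2.2 i).2).1 (ω.2.2 i))

variable (q₁ : BroadcastChannel X₁ Y₁ Z₁) (q₂ : BroadcastChannel X₂ Y₂ Z₂)
  (c : BroadcastCode (X₁ × X₂) (Y₁ × Y₂) (Z₁ × Z₂) n K₀ K₁ K₂)

theorem law_nonneg (ω : CodeSpace Y₁ Z₁ Y₂ Z₂ n K₀ K₁ K₂) : 0 ≤ c.law q₁ q₂ ω :=
  mul_nonneg (by positivity) (mul_nonneg (Finset.prod_nonneg fun _ _ => (q₁ _).2.1 _)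
    (Finset.prod_nonneg fun _ _ => (q₂ _).2.1 _))

theorem isUniform_message : IsUniform (c.law q₁ q₂) fun ω => ω.1 := by
  classical
  intro m
  have hcard : (1 : ℝ) / Fintype.card (Fin K₀ × Fin K₁ × Fin K₂) = ((K₀ : ℝ) * K₁ * K₂)⁻¹ := by
    simp [mul_assoc]
  have sum_outputs (m' : Fin K₀ × Fin K₁ × Fin K₂) :
      ∑ o, c.law q₁ q₂ (m', o) = ((K₀ : ℝ) * K₁ * K₂)⁻¹ := by
    simp only [law, ← Finset.mul_sum, Fintype.sum_prod_type, ← Finset.sum_mul]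
    rw [sum_prod_stdSimplex fun i => q₁ _, sum_prod_stdSimplex fun i => q₂ _,
      mul_one, mul_one]
  rw [hcard, ← sum_outputs m, lawOf, Fintype.sum_prod_type, Finset.sum_eq_single m]
  · simp
  · intro m' _ hm
    simp [hm]
  · simp

theorem sum_law [NeZero K₀] [NeZero K₁] [NeZero K₂] : ∑ ω, c.law q₁ q₂ ω = 1 := by
  rw [← sum_lawOf (c.law q₁ q₂) fun ω => ω.1,
    Finset.sum_congr rfl fun m _ => c.isUniform_message q₁ q₂ m]
  simp only [Finset.sum_const, Finset.card_univ, nsmul_eq_mul]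
  field_simp

theorem isMemorylessOutput_fst :
    IsMemorylessOutput (c.law q₁ q₂)
      (fun ω => (fun i => (ω.2.2 i).2, ω.1.2.1, ω.1.2.2, ω.1.1))
      (fun i ω => (c.enc ω.1.1 ω.1.2.1 ω.1.2.2 i).1) (fun i ω => ((ω.2.1 i).1, (ω.2.1 i).2))
      fun x => (q₁ x).1 :=
  isMemorylessOutput_of_equiv
    (((Equiv.refl _).prodCongr (Equiv.prodComm _ _)).trans (Equiv.prodAssoc _ _ _).symm)
    (Q := fun r : (Fin K₀ × Fin K₁ × Fin K₂) × (Fin n → Y₂ × Z₂) =>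
      ((K₀ : ℝ) * K₁ * K₂)⁻¹ * ∏ i, (q₂ (c.enc r.1.1 r.1.2.1 r.1.2.2 i).2).1 (r.2 i))
    (ξ := fun i r => (c.enc r.1.1 r.1.2.1 r.1.2.2 i).1)
    (fun x => (q₁ x).2.2) (fun ω => by rw [law, mul_left_comm, mul_comm]; rfl)
    fun r => (fun i => (r.2 i).2, r.1.2.1, r.1.2.2, r.1.1)

theorem isMemorylessOutput_snd :
    IsMemorylessOutput (c.law q₁ q₂)
      (fun ω => (fun i => (ω.2.1 i).1, ω.1.2.1, ω.1.2.2, ω.1.1))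
      (fun i ω => (c.enc ω.1.1 ω.1.2.1 ω.1.2.2 i).2) (fun i ω => ((ω.2.2 i).1, (ω.2.2 i).2))
      fun x => (q₂ x).1 :=
  isMemorylessOutput_of_equiv (Equiv.prodAssoc _ _ _).symm
    (Q := fun r : (Fin K₀ × Fin K₁ × Fin K₂) × (Fin n → Y₁ × Z₁) =>
      ((K₀ : ℝ) * K₁ * K₂)⁻¹ * ∏ i, (q₁ (c.enc r.1.1 r.1.2.1 r.1.2.2 i).1).1 (r.2 i))
    (ξ := fun i r => (c.enc r.1.1 r.1.2.1 r.1.2.2 i).2)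
    (fun x => (q₂ x).2.2) (fun ω => by rw [law, ← mul_assoc]; rfl)
    fun r => (fun i => (r.2 i).1, r.1.2.1, r.1.2.2, r.1.1)

theorem sum_ite_div_eq_sum_law
    (E : (Fin K₀ × Fin K₁ × Fin K₂) → (Fin n → Y₁ × Y₂) → (Fin n → Z₁ × Z₂) → Prop)
    [∀ m y z, Decidable (E m y z)] :
    (∑ m₀, ∑ m₁, ∑ m₂, ∑ y, ∑ z, if E (m₀, m₁, m₂) y z
        then ∏ i, ((q₁.prod q₂) (c.enc m₀ m₁ m₂ i)).1 (y i, z i) else 0) / ((K₀ : ℝ) * K₁ * K₂)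
      = ∑ ω : CodeSpace Y₁ Z₁ Y₂ Z₂ n K₀ K₁ K₂,
        if E ω.1 (fun i => ((ω.2.1 i).1, (ω.2.2 i).1)) (fun i => ((ω.2.1 i).2, (ω.2.2 i).2))
          then c.law q₁ q₂ ω else 0 := by
  rw [Fintype.sum_prod_type]
  simp only [← (componentOutputs Y₁ Z₁ Y₂ Z₂ n).sum_comp]
  simp only [Fintype.sum_prod_type, div_eq_inv_mul, Finset.mul_sum, mul_ite, mul_zero,
    componentOutputs, Equiv.coe_fn_mk, Prod.mk.eta, BroadcastChannel.prod, law,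
    Finset.prod_mul_distrib]

theorem errY_prod_eq : c.errY (q₁.prod q₂) = ∑ ω : CodeSpace Y₁ Z₁ Y₂ Z₂ n K₀ K₁ K₂,
    if c.decY (fun i => ((ω.2.1 i).1, (ω.2.2 i).1)) ≠ (ω.1.1, ω.1.2.1)
      then c.law q₁ q₂ ω else 0 :=
  c.sum_ite_div_eq_sum_law q₁ q₂ fun m y _ => c.decY y ≠ (m.1, m.2.1)

theorem errZ_prod_eq : c.errZ (q₁.prod q₂) = ∑ ω : CodeSpace Y₁ Z₁ Y₂ Z₂ n K₀ K₁ K₂,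
    if c.decZ (fun i => ((ω.2.1 i).2, (ω.2.2 i).2)) ≠ (ω.1.1, ω.1.2.2)
      then c.law q₁ q₂ ω else 0 :=
  c.sum_ite_div_eq_sum_law q₁ q₂ fun m _ z => c.decZ z ≠ (m.1, m.2.2)

theorem condEntropyOf_messages_outputY_le [NeZero K₀] [NeZero K₁] [NeZero K₂] :
    condEntropyOf (c.law q₁ q₂) (fun ω => (ω.1.1, ω.1.2.1))
        (blockPair (fun i ω => (ω.2.1 i).1) fun i ω => (ω.2.2 i).1)
      ≤ 1 + c.errY (q₁.prod q₂) * (Real.logb 2 K₀ + Real.logb 2 K₁) := by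
  have hK : Real.logb 2 K₀ + Real.logb 2 K₁ = Real.logb 2 (Fintype.card (Fin K₀ × Fin K₁)) := by
    simp [Real.logb_mul, NeZero.ne]
  rw [hK, errY_prod_eq]
  convert condEntropyOf_le_of_decoder (c.law_nonneg q₁ q₂) (c.sum_law q₁ q₂)
    (fun ω => (ω.1.1, ω.1.2.1)) (blockPair (fun i ω => (ω.2.1 i).1) fun i ω => (ω.2.2 i).1)
    fun t => c.decY fun i => (t.1 i, t.2 i) <;> rfl

theorem condEntropyOf_messages_outputZ_le [NeZero K₀] [NeZero K₁] [NeZero K₂] :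
    condEntropyOf (c.law q₁ q₂) (fun ω => (ω.1.1, ω.1.2.2))
        (blockPair (fun i ω => (ω.2.1 i).2) fun i ω => (ω.2.2 i).2)
      ≤ 1 + c.errZ (q₁.prod q₂) * (Real.logb 2 K₀ + Real.logb 2 K₂) := by
  have hK : Real.logb 2 K₀ + Real.logb 2 K₂ = Real.logb 2 (Fintype.card (Fin K₀ × Fin K₂)) := by
    simp [Real.logb_mul, NeZero.ne]
  rw [hK, errZ_prod_eq]
  convert condEntropyOf_le_of_decoder (c.law_nonneg q₁ q₂) (c.sum_law q₁ q₂)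
    (fun ω => (ω.1.1, ω.1.2.2)) (blockPair (fun i ω => (ω.2.1 i).2) fun i ω => (ω.2.2 i).2)
    fun t => c.decZ fun i => (t.1 i, t.2 i) <;> rfl

theorem mem_entropyOuterBound [Fintype X₁] [Fintype X₂] [NeZero K₀] [NeZero K₁] [NeZero K₂]
    (hn : 0 < n) {ε : ℝ}
    (hY : 1 + c.errY (q₁.prod q₂) * (Real.logb 2 K₀ + Real.logb 2 K₁) ≤ ε)
    (hZ : 1 + c.errZ (q₁.prod q₂) * (Real.logb 2 K₀ + Real.logb 2 K₂) ≤ ε) {R : ℝ × ℝ × ℝ}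
    (h₀ : n * R.1 ≤ Real.logb 2 K₀ - ε) (h₁ : n * R.2.1 ≤ Real.logb 2 K₁ - ε)
    (h₂ : n * R.2.2 ≤ Real.logb 2 K₂ - ε) : R ∈ entropyOuterBound q₁ q₂ := by
  let P := c.law q₁ q₂
  let w : CodeSpace Y₁ Z₁ Y₂ Z₂ n K₀ K₁ K₂ → Fin K₀ := fun ω => ω.1.1
  let u : CodeSpace Y₁ Z₁ Y₂ Z₂ n K₀ K₁ K₂ → Fin K₁ := fun ω => ω.1.2.1
  let v : CodeSpace Y₁ Z₁ Y₂ Z₂ n K₀ K₁ K₂ → Fin K₂ := fun ω => ω.1.2.2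
  have hP : ∀ ω, 0 ≤ P ω := c.law_nonneg q₁ q₂
  have uniform : IsUniform P fun ω => (w ω, u ω, v ω) := c.isUniform_message q₁ q₂
  have uniform_uvw : IsUniform P fun ω => (u ω, v ω, w ω) :=
    (uniform.equiv (Equiv.prodComm _ _)).equiv (Equiv.prodAssoc _ _ _)
  have uniform_uw : IsUniform P fun ω => (u ω, w ω) :=
    (uniform.equiv (Equiv.prodAssoc _ _ _).symm).fst.swap
  have hw : entropyOf P w = Real.logb 2 K₀ := by simpa using entropyOf_uniform uniform.fst
  have hu : condEntropyOf P u w = Real.logb 2 K₁ := by simpa using uniform_uw.condEntropyOf_eq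
  have hv : condEntropyOf P v w = Real.logb 2 K₂ := by
    simpa using uniform_uvw.swap.fst.condEntropyOf_eq
  have fanoY := (c.condEntropyOf_messages_outputY_le q₁ q₂).trans hY
  have fanoZ := (c.condEntropyOf_messages_outputZ_le q₁ q₂).trans hZ
  refine EntropyPoint.exists_mem_entropyRegion hP (c.sum_law q₁ q₂) hn
    (c.isMemorylessOutput_fst q₁ q₂) (c.isMemorylessOutput_snd q₁ q₂)
    (φ₁ := fun i t => (c.enc t.2.2 t.1 t.2.1 i).1) (fun _ _ => rfl)
    (φ₂ := fun i t => (c.enc t.2.2 t.1 t.2.1 i).2) (fun _ _ => rfl)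
    uniform_uvw.condMutInfo_eq_zero ?_ ?_ ?_ ?_
  · exact (by linarith : n * R.1 ≤ _).trans
      (entropyOf_sub_condEntropyOf_prodMk_le_mutInfo hP w u _)
  · exact (by linarith : n * R.1 ≤ _).trans
      (entropyOf_sub_condEntropyOf_prodMk_le_mutInfo hP w v _)
  · exact (by linarith : n * R.2.1 ≤ _).trans
      (condEntropyOf_sub_condEntropyOf_prodMk_le_condMutInfo hP w u _)
  · exact (by linarith : n * R.2.2 ≤ _).trans
      (condEntropyOf_sub_condEntropyOf_prodMk_le_condMutInfo hP w v _)

theorem errY_nonneg {X Y Z : Type*} [Fintype Y] [Fintype Z] (q : BroadcastChannel X Y Z)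
    (c : BroadcastCode X Y Z n K₀ K₁ K₂) : 0 ≤ c.errY q :=
  div_nonneg (Finset.sum_nonneg fun _ _ => Finset.sum_nonneg fun _ _ => Finset.sum_nonneg fun _ _ =>
    Finset.sum_nonneg fun _ _ => Finset.sum_nonneg fun _ _ =>
    ite_nonneg (Finset.prod_nonneg fun _ _ => (q _).2.1 _) le_rfl) (by positivity)

theorem errZ_nonneg {X Y Z : Type*} [Fintype Y] [Fintype Z] (q : BroadcastChannel X Y Z)
    (c : BroadcastCode X Y Z n K₀ K₁ K₂) : 0 ≤ c.errZ q :=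
  div_nonneg (Finset.sum_nonneg fun _ _ => Finset.sum_nonneg fun _ _ => Finset.sum_nonneg fun _ _ =>
    Finset.sum_nonneg fun _ _ => Finset.sum_nonneg fun _ _ =>
    ite_nonneg (Finset.prod_nonneg fun _ _ => (q _).2.1 _) le_rfl) (by positivity)

end BroadcastCode

end Codes

section Achievability

theorem one_le_numMessages (n : ℕ) {R : ℝ} (hR : 0 ≤ R) : 1 ≤ numMessages n R :=
  Nat.floor_pos.2 (Real.one_le_rpow one_le_two (by positivity))

theorem logb_numMessages_le (n : ℕ) {R : ℝ} (hR : 0 ≤ R) :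
    Real.logb 2 (numMessages n R) ≤ n * R := by
  rw [Real.logb_le_iff_le_rpow one_lt_two (by exact_mod_cast one_le_numMessages n hR)]
  exact Nat.floor_le (by positivity)

theorem sub_one_le_logb_numMessages (n : ℕ) {R : ℝ} (hR : 0 ≤ R) :
    n * R - 1 ≤ Real.logb 2 (numMessages n R) := by
  have h1 : (1 : ℝ) ≤ numMessages n R := by exact_mod_cast one_le_numMessages n hR
  have h2 : (2 : ℝ) ^ ((n : ℝ) * R) < numMessages n R + 1 := Nat.lt_floor_add_one _
  rw [Real.le_logb_iff_rpow_le one_lt_two (by linarith), Real.rpow_sub_one two_ne_zero]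
  linarith

variable {X₁ Y₁ Z₁ X₂ Y₂ Z₂ : Type*} [Fintype X₁] [Fintype Y₁] [Fintype Z₁] [Fintype X₂]
  [Fintype Y₂] [Fintype Z₂]

theorem BroadcastCode.sub_mem_entropyOuterBound {q₁ : BroadcastChannel X₁ Y₁ Z₁}
    {q₂ : BroadcastChannel X₂ Y₂ Z₂} {n : ℕ} (hn : 0 < n) {R : ℝ × ℝ × ℝ} (h₀ : 0 ≤ R.1)
    (h₁ : 0 ≤ R.2.1) (h₂ : 0 ≤ R.2.2)
    (c : BroadcastCode (X₁ × X₂) (Y₁ × Y₂) (Z₁ × Z₂) n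
      (numMessages n R.1) (numMessages n R.2.1) (numMessages n R.2.2)) {t : ℝ}
    (ht : t = 2 / n + (c.errY (q₁.prod q₂) * (R.1 + R.2.1)
      + c.errZ (q₁.prod q₂) * (R.1 + R.2.2))) :
    (R.1 - t, R.2.1 - t, R.2.2 - t) ∈ entropyOuterBound q₁ q₂ := by
  have neZero {r : ℝ} (hr : 0 ≤ r) : NeZero (numMessages n r) :=
    ⟨Nat.one_le_iff_ne_zero.1 (one_le_numMessages n hr)⟩
  have := neZero h₀
  have := neZero h₁
  have := neZero h₂
  have hn' : (n : ℝ) ≠ 0 := by positivity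
  have eY := c.errY_nonneg (q₁.prod q₂)
  have eZ := c.errZ_nonneg (q₁.prod q₂)
  have hY := mul_le_mul_of_nonneg_left
    (add_le_add (logb_numMessages_le n h₀) (logb_numMessages_le n h₁)) eY
  have hZ := mul_le_mul_of_nonneg_left
    (add_le_add (logb_numMessages_le n h₀) (logb_numMessages_le n h₂)) eZ
  have hnt : n * t = 2 + (c.errY (q₁.prod q₂) * (n * R.1 + n * R.2.1)
      + c.errZ (q₁.prod q₂) * (n * R.1 + n * R.2.2)) := by
    rw [ht]
    field_simp
  have posY : 0 ≤ c.errY (q₁.prod q₂) * (n * R.1 + n * R.2.1) :=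
    mul_nonneg eY (by positivity)
  have posZ : 0 ≤ c.errZ (q₁.prod q₂) * (n * R.1 + n * R.2.2) :=
    mul_nonneg eZ (by positivity)
  have rate_le {r : ℝ} (hr : 0 ≤ r) :
      n * (r - t) ≤ Real.logb 2 (numMessages n r) - (n * t - 1) := by
    linarith [sub_one_le_logb_numMessages n hr]
  exact c.mem_entropyOuterBound q₁ q₂ hn (ε := n * t - 1) (by linarith) (by linarith)
    (rate_le h₀) (rate_le h₁) (rate_le h₂)

theorem IsAchievable.mem_entropyOuterBound {q₁ : BroadcastChannel X₁ Y₁ Z₁}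
    {q₂ : BroadcastChannel X₂ Y₂ Z₂} {R : ℝ × ℝ × ℝ} (h : IsAchievable (q₁.prod q₂) R) :
    R ∈ entropyOuterBound q₁ q₂ := by
  obtain ⟨h₀, h₁, h₂, c, hY, hZ⟩ := h
  let t : ℕ → ℝ := fun n => 2 / n + ((c n).errY (q₁.prod q₂) * (R.1 + R.2.1)
    + (c n).errZ (q₁.prod q₂) * (R.1 + R.2.2))
  have ht : Tendsto t atTop (𝓝 0) := by
    simpa using (tendsto_const_div_atTop_nhds_zero_nat 2).add
      ((hY.mul_const (R.1 + R.2.1)).add (hZ.mul_const (R.1 + R.2.2)))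
  have hlim : Tendsto (fun n => (R.1 - t n, R.2.1 - t n, R.2.2 - t n)) atTop (𝓝 R) := by
    simpa using (ht.const_sub R.1).prodMk_nhds
      ((ht.const_sub R.2.1).prodMk_nhds (ht.const_sub R.2.2))
  refine (isClosed_entropyOuterBound q₁ q₂).mem_of_tendsto hlim ?_
  filter_upwards [eventually_gt_atTop 0] with n hn
  exact (c n).sub_mem_entropyOuterBound hn h₀ h₁ h₂ rfl

end Achievability

theorem mainTheorem1 {X₁ Y₁ Z₁ X₂ Y₂ Z₂ : Type*}
    [Fintype X₁] [Fintype Y₁] [Fintype Z₁] [Fintype X₂] [Fintype Y₂] [Fintype Z₂]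
    (q₁ : BroadcastChannel X₁ Y₁ Z₁) (q₂ : BroadcastChannel X₂ Y₂ Z₂) :
    capacityRegion (BroadcastChannel.prod q₁ q₂) ⊆ productOuterBound q₁ q₂ :=
  (closure_minimal (fun _ h => IsAchievable.mem_entropyOuterBound h)
    (isClosed_entropyOuterBound q₁ q₂)).trans (entropyOuterBound_subset_productOuterBound q₁ q₂)
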